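/- **Theorem 1.4.** Let $n\ge 1$, let $\mathbb{B}_n$ be the open unit ball of $\mathbb{C}^n$ with $\langle z,u\rangle=\sum_j z_j\overline{u_j}$, and let $\upsilon$ be the volume measure on $\mathbb{B}_n$ normalized by $\upsilon(\mathbb{B}_n)=1$. For $\theta>-1$ put $d\upsilon_\theta(z)=c_\theta(1-|z|^2)^\theta\,d\upsilon(z)$ with $c_\theta=\frac{\Gamma(n+\theta+1)}{n!\,\Gamma(\theta+1)}$. For $\vec p=(p_1,p_2)\in[1,\infty)^2$ and $\vec\alpha=(\alpha_1,\alpha_2)\in(-1,\infty)^2$ let $L^{\vec p}_{\vec\alpha}$ be the space of measurable $f:\mathbb{B}_n\times\mathbb{B}_n\to\mathbb{C}$ with $$\|f\|_{L^{\vec p}_{\vec\alpha}}=\Big\{\int_{\mathbb{B}_n}\Big[\int_{\mathbb{B}_n}|f(z,w)|^{p_1}\,d\upsilon_{\alpha_1}(z)\Big]^{p_2/p_1}d\upsilon_{\alpha_2}(w)\Big\}^{1/p_2}<\infty .$$ For $\vec a,\vec b,\vec c\in\mathbb{R}^2$ put $$T_{\vec a,\vec b,\vec c}f(z,w)=(1-|z|^2)^{a_1}(1-|w|^2)^{a_2}\int_{\mathbb{B}_n}\int_{\mathbb{B}_n}\frac{(1-|u|^2)^{b_1}(1-|\eta|^2)^{b_2}}{(1-\langle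 z,u\rangle)^{c_1}(1-\langle w,\eta\rangle)^{c_2}}f(u,\eta)\,d\upsilon(u)\,d\upsilon(\eta)$$ (principal powers), and let $S_{\vec a,\vec b,\vec c}$ be defined by the same formula with $|1-\langle z,u\rangle|^{c_1}|1-\langle w,\eta\rangle|^{c_2}$ as denominator. Such an operator is called bounded from $L^{\vec p}_{\vec\alpha}$ to $L^{\vec q}_{\vec\beta}$ if for every $f\in L^{\vec p}_{\vec\alpha}$ the defining integral converges absolutely for almost every $(z,w)$ and the resulting function lies in $L^{\vec q}_{\vec\beta}$ with norm at most $C\|f\|_{L^{\vec p}_{\vec\alpha}}$, where $C<\infty$ does not depend on $f$. Let $\vec a,\vec b,\vec c\in\mathbb{R}^2$, $\vec\alpha,\vec\beta\in(-1,\infty)^2$, $\vec p=(1,1)$ and $\vec q=(q_1,q_2)\in[1,\infty)^2$. Then the following statements are equivalent. (i) $S_{\vec a,\vec b,\vec c}$ is bounded from $L^{(1,1)}_{\vec\alpha}$ to $L^{\vec q}_{\vec\beta}$. (ii) $T_{\vec a,\vec b,\vec c}$ is bounded from $L^{(1,1)}_{\vec\alpha}$ to $L^{\vec q}_{\vec\beta}$.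 (iii) $-q_ia_i<\beta_i+1$ for $i=1,2$, and one of the following four systems holds: 1. $\alpha_i<b_i$ and $c_i\le a_i+b_i-\alpha_i+\frac{n+1+\beta_i}{q_i}$ for $i=1,2$; 2. $\alpha_i=b_i$ and $c_i<a_i+\frac{n+1+\beta_i}{q_i}$ for $i=1,2$; 3. $\alpha_1=b_1$, $c_1<a_1+\frac{n+1+\beta_1}{q_1}$, $\alpha_2<b_2$ and $c_2\le a_2+b_2-\alpha_2+\frac{n+1+\beta_2}{q_2}$; 4. $\alpha_1<b_1$, $c_1\le a_1+b_1-\alpha_1+\frac{n+1+\beta_1}{q_1}$, $\alpha_2=b_2$ and $c_2<a_2+\frac{n+1+\beta_2}{q_2}$. -/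

import Mathlib

open MeasureTheory
open scoped ENNReal NNReal

noncomputable section

namespace ForelliRudin

/-- The Hermitian space `ℂⁿ` with its Euclidean norm. -/
abbrev Cn (n : ℕ) : Type := EuclideanSpace ℂ (Fin n)

/-- The pairing `⟨z, u⟩ = ∑ i, z i * conj (u i)`, linear in the first variable. -/
def pairing {n : ℕ} (z u : Cn n) : ℂ := ∑ i, z i * (starRingEnd ℂ) (u i)

/-- The normalized volume measure `υ` of the open unit ball, `υ(𝔹ₙ) = 1`. It is regarded as a
measure on `ℂⁿ` that is carried by the ball. -/
def ballMeasure (n : ℕ) : Measure (Cn n) :=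
  (volume (Metric.ball (0 : Cn n) 1))⁻¹ • volume.restrict (Metric.ball (0 : Cn n) 1)

instance ballMeasure_isProbabilityMeasure (n : ℕ) : IsProbabilityMeasure (ballMeasure n) := by
  refine ⟨?_⟩
  have h0 : volume (Metric.ball (0 : Cn n) 1) ≠ 0 :=
    (Metric.measure_ball_pos volume (0 : Cn n) one_pos).ne'
  have h1 : volume (Metric.ball (0 : Cn n) 1) ≠ ∞ := measure_ball_lt_top.ne
  simp [ballMeasure, ENNReal.inv_mul_cancel h0 h1]

/-- The normalizing constant `c_θ = Γ(n + θ + 1) / (n! Γ(θ + 1))`. -/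
def normConst (n : ℕ) (θ : ℝ) : ℝ :=
  Real.Gamma (n + θ + 1) / (n.factorial * Real.Gamma (θ + 1))

/-- The weighted measure `dυ_θ(z) = c_θ (1 - |z|²)^θ dυ(z)`, used for `θ > -1`. -/
def weightedMeasure (n : ℕ) (θ : ℝ) : Measure (Cn n) :=
  (ballMeasure n).withDensity fun z => ENNReal.ofReal (normConst n θ * (1 - ‖z‖ ^ 2) ^ θ)

/-- The weighted mixed norm, with the inner integral in the first variable, for finite
exponents:
`{∫ [∫ |f(z,w)|^{p₁} dυ_{α₁}(z)]^{p₂/p₁} dυ_{α₂}(w)}^{1/p₂}`, with values in `[0,∞]`. -/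
def mixedNorm {n : ℕ} (p α : Fin 2 → ℝ) (f : Cn n × Cn n → ℂ) : ℝ≥0∞ :=
  (∫⁻ w, (∫⁻ z, ‖f (z, w)‖ₑ ^ (p 0) ∂(weightedMeasure n (α 0))) ^ (p 1 / p 0)
    ∂(weightedMeasure n (α 1))) ^ (1 / p 1)

/-- Membership in the weighted mixed-norm Lebesgue space on `𝔹ₙ × 𝔹ₙ`: `f` is measurable (up to
a null set) and has finite mixed norm. Values of `f` off `𝔹ₙ × 𝔹ₙ` play no role. -/
def MemMixedLp {n : ℕ} (p α : Fin 2 → ℝ) (f : Cn n × Cn n → ℂ) : Prop :=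
  AEStronglyMeasurable f ((ballMeasure n).prod (ballMeasure n)) ∧ mixedNorm p α f < ∞

/-- The factor `(1 - |z|²)^{s₁} (1 - |w|²)^{s₂}` at `x = (z, w)`. -/
def weight {n : ℕ} (s : Fin 2 → ℝ) (x : Cn n × Cn n) : ℝ :=
  (1 - ‖x.1‖ ^ 2) ^ (s 0) * (1 - ‖x.2‖ ^ 2) ^ (s 1)

/-- The integrand factor of `T`. The power is the principal one; `1 - ⟨z, u⟩` has positive real
part for `z, u` in the ball. -/
def kernelT {n : ℕ} (b c : Fin 2 → ℝ) (x y : Cn n × Cn n) : ℂ :=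
  (weight b y : ℂ) /
    ((1 - pairing x.1 y.1) ^ ((c 0 : ℝ) : ℂ) * (1 - pairing x.2 y.2) ^ ((c 1 : ℝ) : ℂ))

/-- The integrand factor of `S`. -/
def kernelS {n : ℕ} (b c : Fin 2 → ℝ) (x y : Cn n × Cn n) : ℂ :=
  ((weight b y / (‖1 - pairing x.1 y.1‖ ^ (c 0) * ‖1 - pairing x.2 y.2‖ ^ (c 1)) : ℝ) : ℂ)

/-- `f ↦ (1 - |z|²)^{a₁} (1 - |w|²)^{a₂} ∬ K((z,w),(u,η)) f(u,η) dυ(u) dυ(η)`. -/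
def integralOp {n : ℕ} (a : Fin 2 → ℝ) (K : Cn n × Cn n → Cn n × Cn n → ℂ)
    (f : Cn n × Cn n → ℂ) (x : Cn n × Cn n) : ℂ :=
  (weight a x : ℂ) * ∫ y, K x y * f y ∂((ballMeasure n).prod (ballMeasure n))

/-- The operator `integralOp a K` is bounded from the mixed-norm space with data `(p, α)` to the
one with data `(q, β)`: for every `f` in the first space the defining integral converges
absolutely at almost every point, the image lies in the second space, and the norm inequality
holds with a constant that does not depend on `f`. -/
def IsBoundedOp {n : ℕ} (p α q β : Fin 2 → ℝ) (a : Fin 2 → ℝ)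
    (K : Cn n × Cn n → Cn n × Cn n → ℂ) : Prop :=
  ∃ C : ℝ≥0, ∀ f : Cn n × Cn n → ℂ, MemMixedLp p α f →
    (∀ᵐ x ∂((ballMeasure n).prod (ballMeasure n)),
      Integrable (fun y => K x y * f y) ((ballMeasure n).prod (ballMeasure n))) ∧
    MemMixedLp q β (integralOp a K f) ∧
    mixedNorm q β (integralOp a K f) ≤ C * mixedNorm p α f

/-- The multiparameter operator `S_{a,b,c}` is bounded from `L^p_α` to `L^q_β`. -/
def BoundedS (n : ℕ) (a b c p α q β : Fin 2 → ℝ) : Prop :=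
  IsBoundedOp (n := n) p α q β a (kernelS b c)

/-- The multiparameter operator `T_{a,b,c}` is bounded from `L^p_α` to `L^q_β`. -/
def BoundedT (n : ℕ) (a b c p α q β : Fin 2 → ℝ) : Prop :=
  IsBoundedOp (n := n) p α q β a (kernelT b c)

end ForelliRudin

end

/-! On `L¹` an operator is controlled by its columns: the unit ball is generated by normalized point
masses, so boundedness into `L^q` means that the column `x ↦ weight a x * K x y` has mixed norm at
most a constant times `weight α y`, uniformly in `y`. Only the modulus of the kernel enters this
condition, and the kernels of `S` and `T` have the same modulus; hence (i) and (ii) are equivalent.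
Necessity comes from testing on indicators of shrinking balls and Fatou's lemma
(`le_of_isBoundedOp`), sufficiency from a Minkowski inequality (`isBoundedOp_of_profile_le`).

The modulus is a product of one factor in `(z, u)` and one in `(w, η)`, so the mixed norm of a
column factors as well, and putting one variable at the origin separates the two conditions. By
`isBoundedOp_iff`, what remains for each `i` is that `∫ (1 - |z|²)^t |1 - ⟨z,u⟩|^(-e) dz` is `O((1 -
|u|²)^(-s))`, with `t = q a + β`, `e = q c`, `s = q (b - α)`.

These are the Forelli-Rudin estimates. Rotating `u` onto an axis and integrating out the other
coordinates (`frIntegral_eq`) reduces them to a disc integral with weight exponent `T = t + n - 1`.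
In polar coordinates, with `δ = 1 - r` and `v` the distance to the circle, `|1 - rζ|` is comparable
to `δ + v + |θ|`. The integral of `v^T (δ + v + |θ|)^(-e)` is bounded for `e < T + 2`, logarithmic
for `e = T + 2`, and of size `δ^(T + 2 - e)` beyond. It is also bounded below, so growth `δ^(-s)`
forces `s ≥ 0`, with `e < T + 2` if `s = 0` and `e ≤ T + 2 + s` if `s > 0`. The weight is integrable
exactly when `t > -1`. Expanding the alternatives `s = 0` and `s > 0` over two variables gives the
four systems of (iii). -/

noncomputable section

namespace ForelliRudin

/-! ### Disc integrals in polar coordinates -/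

/-- The Forelli-Rudin integral over the unit disc. -/
def discIntegral (T e r : ℝ) : ℝ≥0∞ :=
  ∫⁻ ζ in Metric.ball (0 : ℂ) 1,
    ENNReal.ofReal ((1 - ‖ζ‖ ^ 2) ^ T * ‖1 - (r : ℂ) * ζ‖ ^ (-e))

lemma measurable_disc_integrand (T e r : ℝ) : Measurable fun ζ : ℂ =>
    ENNReal.ofReal ((1 - ‖ζ‖ ^ 2) ^ T * ‖1 - (r : ℂ) * ζ‖ ^ (-e)) := by
  fun_prop

/-- The point of the unit disc at distance `v` from the circle and with argument `θ`. -/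
def polarPt (v θ : ℝ) : ℂ := ((1 - v : ℝ) : ℂ) * Complex.exp (θ * Complex.I)

@[fun_prop] lemma measurable_polarPt : Measurable fun p : ℝ × ℝ => polarPt p.1 p.2 := by
  unfold polarPt; fun_prop

lemma norm_polarPt {v θ : ℝ} (hv : v ≤ 1) : ‖polarPt v θ‖ = 1 - v := by
  rw [polarPt, norm_mul, Complex.norm_exp_ofReal_mul_I, mul_one, Complex.norm_real,
    Real.norm_of_nonneg (by linarith)]

lemma discIntegral_eq_polar (T e r : ℝ) :
    discIntegral T e r = ∫⁻ v in Set.Ioo (0 : ℝ) 1, ∫⁻ θ in Set.Ioo (-Real.pi) Real.pi,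
      ENNReal.ofReal ((1 - v) * ((v * (2 - v)) ^ T * ‖1 - (r : ℂ) * polarPt v θ‖ ^ (-e))) := by
  have hm : Measurable fun p : ℝ × ℝ => ENNReal.ofReal
      ((1 - p.1) * ((p.1 * (2 - p.1)) ^ T * ‖1 - (r : ℂ) * polarPt p.1 p.2‖ ^ (-e))) := by
    fun_prop
  have h1 := Complex.lintegral_comp_polarCoord_symm
    ((Metric.ball (0 : ℂ) 1).indicator fun ζ : ℂ =>
      ENNReal.ofReal ((1 - ‖ζ‖ ^ 2) ^ T * ‖1 - (r : ℂ) * ζ‖ ^ (-e)))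
  rw [lintegral_indicator measurableSet_ball] at h1
  rw [discIntegral, ← h1]
  have htgt : polarCoord.target = Set.Ioi (0 : ℝ) ×ˢ Set.Ioo (-Real.pi) Real.pi := rfl
  rw [htgt]
  -- The unsimplified `1 - (1 - p.1)` anticipates the substitution `v = 1 - ρ` made below.
  have h2 : ∀ p ∈ Set.Ioi (0 : ℝ) ×ˢ Set.Ioo (-Real.pi) Real.pi,
      ENNReal.ofReal p.1 • (Metric.ball (0 : ℂ) 1).indicator (fun ζ : ℂ =>
        ENNReal.ofReal ((1 - ‖ζ‖ ^ 2) ^ T * ‖1 - (r : ℂ) * ζ‖ ^ (-e)))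
          (Complex.polarCoord.symm p) =
      (Set.Iio (1 : ℝ) ×ˢ Set.univ).indicator (fun p : ℝ × ℝ => ENNReal.ofReal
      ((1 - (1 - p.1)) * (((1 - p.1) * (2 - (1 - p.1))) ^ T *
        ‖1 - (r : ℂ) * polarPt (1 - p.1) p.2‖ ^ (-e)))) p := by
    rintro ⟨ρ, θ⟩ ⟨hρ, -⟩
    have hρ : 0 < ρ := hρ
    have hs : Complex.polarCoord.symm (ρ, θ) = polarPt (1 - ρ) θ := by
      rw [Complex.polarCoord_symm_apply, polarPt, Complex.exp_mul_I]
      simp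
    rw [hs]
    have hn : ‖polarPt (1 - ρ) θ‖ = ρ := by rw [norm_polarPt (by linarith)]; ring
    by_cases h : ρ < 1
    · rw [Set.indicator_of_mem (by simp [hn, h]), Set.indicator_of_mem (by simp [h]), hn,
        smul_eq_mul, ← ENNReal.ofReal_mul hρ.le]
      congr 3
      · ring_nf
      · congr 2; ring_nf
    · rw [Set.indicator_of_notMem (by simp [hn]; linarith),
        Set.indicator_of_notMem (by simp; linarith)]
      simp
  rw [setLIntegral_congr_fun (measurableSet_Ioi.prod measurableSet_Ioo) h2,
    setLIntegral_indicator (measurableSet_Iio.prod MeasurableSet.univ), Set.prod_inter_prod,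
    Set.univ_inter, Set.Iio_inter_Ioi, Measure.volume_eq_prod, ← Measure.prod_restrict,
    lintegral_prod _ (by fun_prop)]
  have h3 := (Measure.measurePreserving_sub_left (volume : Measure ℝ) 1).setLIntegral_comp_preimage
    (s := Set.Ioo (0 : ℝ) 1) measurableSet_Ioo
    (f := fun v => ∫⁻ θ in Set.Ioo (-Real.pi) Real.pi, ENNReal.ofReal
      ((1 - v) * ((v * (2 - v)) ^ T * ‖1 - (r : ℂ) * polarPt v θ‖ ^ (-e))))
    hm.lintegral_prod_right'
  rw [← h3]
  simp

/-- Factors such as `2 - v` and `1 + r` stay in `[1/2, 2]`, so their powers, of either sign, cost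
only a constant. -/
lemma rpow_bounds_of_mem_Icc {x : ℝ} (T : ℝ) (h0 : 1 / 2 ≤ x) (h1 : x ≤ 2) :
    (2 : ℝ) ^ (-|T|) ≤ x ^ T ∧ x ^ T ≤ 2 ^ |T| := by
  have hx : 0 < x := by linarith
  have hl : |Real.log x| ≤ Real.log 2 := by
    rw [abs_le, ← Real.log_inv]
    exact ⟨Real.log_le_log (by norm_num) (by linarith), Real.log_le_log hx h1⟩
  have h2 : |Real.log x * T| ≤ Real.log 2 * |T| := by
    rw [abs_mul]; gcongr
  rw [Real.rpow_def_of_pos hx, Real.rpow_def_of_pos two_pos, Real.rpow_def_of_pos two_pos,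
    Real.exp_le_exp, Real.exp_le_exp]
  rw [abs_le] at h2
  exact ⟨by linarith [h2.1], h2.2⟩

/-- With `ρ = 1 - v`, `|1 - rρe^{iθ}|² = (1 - rρ)² + 4rρ sin²(θ/2)`. If `rρ ≤ 1/2` the modulus is at
least `1/2` and `|θ| ≤ π` is harmless; otherwise Jordan's inequality bounds `|θ|` through the sine.
The constant is `9 = 1 + 1 + 7`, from `1 - r ≤ N`, `v ≤ N` and `|θ| ≤ 7N`; `63/20` is a rational
upper bound for `π`. -/
lemma norm_one_sub_polarPt_lower {r v θ : ℝ} (hr0 : 0 ≤ r) (hr : r < 1) (hv0 : 0 < v) (hv : v < 1)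
    (hθ : |θ| ≤ Real.pi) :
    ((1 - r) + v + |θ|) / 9 ≤ ‖1 - (r : ℂ) * polarPt v θ‖ := by
  set N := ‖1 - (r : ℂ) * polarPt v θ‖ with hN
  have hnorm : ‖(r : ℂ) * polarPt v θ‖ = r * (1 - v) := by
    rw [norm_mul, norm_polarPt hv.le, Complex.norm_real, Real.norm_of_nonneg hr0]
  have h1 : 1 - r * (1 - v) ≤ N := by
    have := norm_sub_norm_le (1 : ℂ) ((r : ℂ) * polarPt v θ)
    rwa [hnorm, norm_one] at this
  have hNsq : N ^ 2 = (1 - r * (1 - v)) ^ 2 + 4 * (r * (1 - v)) * Real.sin (θ / 2) ^ 2 := by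
    rw [hN, ← Complex.normSq_eq_norm_sq, polarPt, Complex.exp_mul_I, Complex.normSq_apply]
    have hc : Real.cos θ = 1 - 2 * Real.sin (θ / 2) ^ 2 := by
      have := Real.cos_two_mul (θ / 2)
      have h2 := Real.sin_sq_add_cos_sq (θ / 2)
      rw [show 2 * (θ / 2) = θ by ring] at this
      rw [this]; linarith
    have hs := Real.sin_sq_add_cos_sq θ
    simp [← Complex.ofReal_cos, ← Complex.ofReal_sin]
    have : Real.sin θ ^ 2 = 1 - (1 - 2 * Real.sin (θ / 2) ^ 2) ^ 2 := by rw [← hc]; linarith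
    rw [hc]
    ring_nf
    rw [this]
    ring_nf
  have hpi := Real.pi_gt_three
  have hpi4 := Real.pi_le_four
  have hN0 : 0 ≤ N := norm_nonneg _
  have h2 : |θ| ≤ 7 * N := by
    by_cases hR : r * (1 - v) ≤ 1 / 2
    · have : Real.pi ≤ (63 / 20) := (Real.pi_lt_d2.le.trans (by norm_num))
      linarith
    · push Not at hR
      have hsin : |θ| / (63 / 20) ≤ |Real.sin (θ / 2)| := by
        have h := Real.mul_abs_le_abs_sin (x := θ / 2) (by rw [abs_div, abs_two]; linarith)
        refine le_trans ?_ h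
        rw [abs_div, abs_two]
        have : (1:ℝ) / (63 / 20) ≤ 1 / Real.pi :=
          one_div_le_one_div_of_le (by linarith) (Real.pi_lt_d2.le.trans (by norm_num))
        calc |θ| / (63 / 20) = 1 / (63 / 20) * |θ| := by ring
          _ ≤ 1 / Real.pi * |θ| := by gcongr
          _ = _ := by ring
      have h3 : (|θ| / (63 / 20)) ^ 2 ≤ Real.sin (θ / 2) ^ 2 := by
        rw [← sq_abs (Real.sin _)]; gcongr
      have h4 : (|θ| / (63 / 20)) ^ 2 ≤ N ^ 2 := by
        rw [hNsq]
        nlinarith [sq_nonneg (1 - r * (1 - v)), sq_nonneg (Real.sin (θ / 2))]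
      have hle := (le_abs_self _).trans (abs_le_of_sq_le_sq h4 hN0)
      rw [div_le_iff₀ (by norm_num)] at hle
      linarith
  have h3 : 1 - r ≤ N := by nlinarith
  have h4 : v ≤ N := by nlinarith
  linarith

lemma norm_one_sub_polarPt_upper {r v θ : ℝ} (hr0 : 0 ≤ r) (hr : r < 1) (hv0 : 0 < v)
    (hv : v < 1) : ‖1 - (r : ℂ) * polarPt v θ‖ ≤ (1 - r) + v + |θ| := by
  have h1 : (1 : ℂ) - (r : ℂ) * polarPt v θ = ((1 - r : ℝ) : ℂ) + ((r * v : ℝ) : ℂ) +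
      ((r * (1 - v) : ℝ) : ℂ) * (1 - Complex.exp (θ * Complex.I)) := by
    rw [polarPt]; push_cast; ring
  rw [h1]
  have hexp : ‖1 - Complex.exp (θ * Complex.I)‖ ≤ |θ| := by
    rw [norm_sub_rev, mul_comm (θ : ℂ)]
    exact Real.norm_exp_I_mul_ofReal_sub_one_le
  have h3 := norm_add₃_le (a := ((1 - r : ℝ) : ℂ)) (b := ((r * v : ℝ) : ℂ))
    (c := ((r * (1 - v) : ℝ) : ℂ) * (1 - Complex.exp (θ * Complex.I)))
  rw [norm_mul, Complex.norm_real, Complex.norm_real, Complex.norm_real,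
    Real.norm_of_nonneg (by linarith), Real.norm_of_nonneg (by positivity),
    Real.norm_of_nonneg (by nlinarith)] at h3
  have h4 : r * (1 - v) * ‖1 - Complex.exp (θ * Complex.I)‖ ≤ 1 * |θ| :=
    mul_le_mul (by nlinarith) hexp (norm_nonneg _) (by norm_num)
  nlinarith

/-! ### Upper bounds for the disc integrals -/

lemma setLIntegral_Ioc_rpow {T δ : ℝ} (hT : -1 < T) (hδ : 0 < δ) :
    ∫⁻ v in Set.Ioc 0 δ, ENNReal.ofReal (v ^ T) = ENNReal.ofReal (δ ^ (T + 1) / (T + 1)) := by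
  have hi : IntegrableOn (fun v : ℝ => v ^ T) (Set.Ioc 0 δ) :=
    (intervalIntegrable_iff_integrableOn_Ioc_of_le hδ.le).1
      (intervalIntegral.intervalIntegrable_rpow' hT)
  rw [← ofReal_integral_eq_lintegral_ofReal hi, ← intervalIntegral.integral_of_le hδ.le,
    integral_rpow (Or.inl hT), Real.zero_rpow (by linarith), sub_zero]
  filter_upwards [ae_restrict_mem measurableSet_Ioc] with v hv
  exact Real.rpow_nonneg hv.1.le _

lemma setLIntegral_Ioi_rpow {σ δ : ℝ} (hσ : 0 < σ) (hδ : 0 < δ) :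
    ∫⁻ v in Set.Ioi δ, ENNReal.ofReal (v ^ (-1 - σ)) = ENNReal.ofReal (δ ^ (-σ) / σ) := by
  have hi : IntegrableOn (fun v : ℝ => v ^ (-1 - σ)) (Set.Ioi δ) :=
    integrableOn_Ioi_rpow_of_lt (by linarith) hδ
  rw [← ofReal_integral_eq_lintegral_ofReal hi, integral_Ioi_rpow_of_lt (by linarith) hδ]
  · congr 1
    rw [show -1 - σ + 1 = -σ by ring, neg_div_neg_eq]
  filter_upwards [ae_restrict_mem measurableSet_Ioi] with v hv
  exact Real.rpow_nonneg (hδ.trans hv).le _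

/-- Split at `v = δ`: below it `δ + v` is bounded below by `δ`, above it by `v`, and each piece is
an explicit power integral of order `δ^(-σ)`. -/
lemma setLIntegral_rpow_mul_add_rpow_le {T σ δ : ℝ} (hT : -1 < T) (hσ : 0 < σ) (hδ : 0 < δ) :
    ∫⁻ v in Set.Ioi (0 : ℝ), ENNReal.ofReal (v ^ T * (δ + v) ^ (-(T + 1 + σ))) ≤
      ENNReal.ofReal (1 / (T + 1) + 1 / σ) * ENNReal.ofReal (δ ^ (-σ)) := by
  have hT1 : 0 < T + 1 := by linarith
  have hU : Set.Ioi (0 : ℝ) = Set.Ioc 0 δ ∪ Set.Ioi δ := (Set.Ioc_union_Ioi_eq_Ioi hδ.le).symm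
  rw [hU]
  refine (lintegral_union_le _ _ _).trans ?_
  have h1 : ∫⁻ v in Set.Ioc 0 δ, ENNReal.ofReal (v ^ T * (δ + v) ^ (-(T + 1 + σ))) ≤
      ENNReal.ofReal (1 / (T + 1) * δ ^ (-σ)) := by
    calc _ ≤ ∫⁻ v in Set.Ioc 0 δ, ENNReal.ofReal (v ^ T) *
          ENNReal.ofReal (δ ^ (-(T + 1 + σ))) := by
          refine setLIntegral_mono' measurableSet_Ioc fun v hv => ?_
          rw [← ENNReal.ofReal_mul (Real.rpow_nonneg hv.1.le _)]
          refine ENNReal.ofReal_le_ofReal ?_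
          refine mul_le_mul_of_nonneg_left ?_ (Real.rpow_nonneg hv.1.le _)
          exact Real.rpow_le_rpow_of_nonpos hδ (by linarith [hv.1]) (by linarith)
      _ = _ := by
          rw [lintegral_mul_const' _ _ ENNReal.ofReal_ne_top, setLIntegral_Ioc_rpow hT hδ,
            ← ENNReal.ofReal_mul (by positivity)]
          congr 1
          rw [show -σ = T + 1 + -(T + 1 + σ) by ring, Real.rpow_add hδ (T + 1)]
          ring
  have h2 : ∫⁻ v in Set.Ioi δ, ENNReal.ofReal (v ^ T * (δ + v) ^ (-(T + 1 + σ))) ≤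
      ENNReal.ofReal (1 / σ * δ ^ (-σ)) := by
    calc _ ≤ ∫⁻ v in Set.Ioi δ, ENNReal.ofReal (v ^ (-1 - σ)) := by
          refine setLIntegral_mono' measurableSet_Ioi fun v hv => ?_
          have hv0 : 0 < v := hδ.trans hv
          refine ENNReal.ofReal_le_ofReal ?_
          rw [show -1 - σ = T + -(T + 1 + σ) by ring, Real.rpow_add hv0]
          refine mul_le_mul_of_nonneg_left ?_ (Real.rpow_nonneg hv0.le _)
          exact Real.rpow_le_rpow_of_nonpos hv0 (by linarith) (by linarith)
      _ = _ := by
          rw [setLIntegral_Ioi_rpow hσ hδ]; congr 1; ring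
  refine (add_le_add h1 h2).trans_eq ?_
  rw [← ENNReal.ofReal_add (by positivity) (by positivity), ← ENNReal.ofReal_mul (by positivity)]
  congr 1; ring

lemma setLIntegral_comp_abs_le (a : ℝ) {F : ℝ → ℝ≥0∞} (hF : Measurable F) :
    ∫⁻ θ in Set.Ioo (-a) a, F |θ| ≤ 2 * ∫⁻ θ in Set.Ioo 0 a, F θ := by
  have h0 : ∫⁻ θ in Set.Ioo (-a) a, F |θ| = ∫⁻ θ in Set.Ioo (-a) 0 ∪ Set.Ioo 0 a, F |θ| := by
    refine setLIntegral_congr ?_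
    have : ({0} : Set ℝ)ᶜ ∈ ae (volume : Measure ℝ) := by
      rw [mem_ae_iff, compl_compl]; exact measure_singleton 0
    filter_upwards [this] with θ hθ
    refine propext ⟨fun h => ?_, fun h => ?_⟩
    · rcases lt_or_gt_of_ne (show θ ≠ 0 from hθ) with h1 | h1
      · exact Or.inl ⟨h.1, h1⟩
      · exact Or.inr ⟨h1, h.2⟩
    · rcases h with h | h
      · exact ⟨h.1, by linarith [h.1, h.2]⟩
      · exact ⟨by linarith [h.1, h.2], h.2⟩
  rw [h0, two_mul]
  refine (lintegral_union_le _ _ _).trans (add_le_add (le_of_eq ?_) (le_of_eq ?_))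
  · have := (Measure.measurePreserving_neg (volume : Measure ℝ)).setLIntegral_comp_preimage
      (s := Set.Ioo 0 a) measurableSet_Ioo hF
    rw [← this]
    have hs : (fun x : ℝ => -x) ⁻¹' Set.Ioo 0 a = Set.Ioo (-a) 0 := by simp
    have hs' : Neg.neg ⁻¹' Set.Ioo 0 a = Set.Ioo (-a) 0 := hs
    rw [hs']
    exact setLIntegral_congr_fun measurableSet_Ioo fun θ hθ => by
      simp only [abs_of_neg hθ.2]
  · exact setLIntegral_congr_fun measurableSet_Ioo fun θ hθ => by
      simp only [abs_of_pos hθ.1]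

/-- Separation of variables: dominating the kernel by `A v * B θ` turns the planar integral into a
product of two integrals on the line. How the exponent `e` is shared between `A` and `B` is left to
each application. -/
lemma discIntegral_le_of_le_mul {T e r : ℝ} (he : 0 ≤ e) (hr0 : 0 ≤ r) (hr : r < 1) {A B : ℝ → ℝ}
    (hA : Measurable A) (hA0 : ∀ v, 0 < v → 0 ≤ A v)
    (h : ∀ v, 0 < v → v < 1 → ∀ θ, 0 < θ → θ < Real.pi →
      ((1 - r) + v + θ) ^ (-e) ≤ A v * B θ) :
    discIntegral T e r ≤ ENNReal.ofReal (2 ^ |T| * 9 ^ e) *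
      ((∫⁻ v in Set.Ioo 0 1, ENNReal.ofReal (v ^ T * A v)) *
        (2 * ∫⁻ θ in Set.Ioo 0 Real.pi, ENNReal.ofReal (B θ))) := by
  set X := 2 * ∫⁻ θ in Set.Ioo 0 Real.pi, ENNReal.ofReal (B θ) with hX
  rw [discIntegral_eq_polar]
  have hin : ∀ v ∈ Set.Ioo (0 : ℝ) 1, ∫⁻ θ in Set.Ioo (-Real.pi) Real.pi, ENNReal.ofReal
      ((1 - v) * ((v * (2 - v)) ^ T * ‖1 - (r : ℂ) * polarPt v θ‖ ^ (-e))) ≤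
      ENNReal.ofReal (2 ^ |T| * 9 ^ e) * (ENNReal.ofReal (v ^ T * A v) * X) := by
    rintro v ⟨hv0, hv1⟩
    have hvT : 0 ≤ v ^ T := Real.rpow_nonneg hv0.le _
    have hAv := hA0 v hv0
    calc _ ≤ ∫⁻ θ in Set.Ioo (-Real.pi) Real.pi, ENNReal.ofReal
          ((2 ^ |T| * 9 ^ e) * (v ^ T * ((1 - r) + v + |θ|) ^ (-e))) := by
          refine setLIntegral_mono' measurableSet_Ioo fun θ hθ => ENNReal.ofReal_le_ofReal ?_
          have hθ' : |θ| ≤ Real.pi := (abs_lt.2 hθ).le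
          have hlow := norm_one_sub_polarPt_lower hr0 hr hv0 hv1 hθ'
          have hD : 0 < (1 - r) + v + |θ| := by have := abs_nonneg θ; linarith
          have h1 : ‖1 - (r : ℂ) * polarPt v θ‖ ^ (-e) ≤ 9 ^ e * ((1 - r) + v + |θ|) ^ (-e) := by
            calc _ ≤ (((1 - r) + v + |θ|) / 9) ^ (-e) :=
                  Real.rpow_le_rpow_of_nonpos (by positivity) hlow (by linarith)
              _ = _ := by
                rw [Real.div_rpow hD.le (by norm_num), Real.rpow_neg (x := 9) (by norm_num), div_inv_eq_mul]
                ring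
          have h2 : (v * (2 - v)) ^ T ≤ 2 ^ |T| * v ^ T := by
            rw [Real.mul_rpow hv0.le (by linarith), mul_comm]
            gcongr
            exact (rpow_bounds_of_mem_Icc T (by linarith) (by linarith)).2
          have h3 : 0 ≤ (v * (2 - v)) ^ T := Real.rpow_nonneg (by nlinarith) _
          calc _ ≤ 1 * ((v * (2 - v)) ^ T * ‖1 - (r : ℂ) * polarPt v θ‖ ^ (-e)) := by
                gcongr; linarith
            _ ≤ 1 * ((2 ^ |T| * v ^ T) * (9 ^ e * ((1 - r) + v + |θ|) ^ (-e))) := by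
                gcongr
            _ = _ := by ring
      _ ≤ 2 * ∫⁻ θ in Set.Ioo 0 Real.pi, ENNReal.ofReal
          ((2 ^ |T| * 9 ^ e) * (v ^ T * ((1 - r) + v + θ) ^ (-e))) :=
          setLIntegral_comp_abs_le Real.pi (F := fun θ => ENNReal.ofReal
          ((2 ^ |T| * 9 ^ e) * (v ^ T * ((1 - r) + v + θ) ^ (-e)))) (by fun_prop)
      _ ≤ 2 * ∫⁻ θ in Set.Ioo 0 Real.pi, ENNReal.ofReal ((2 ^ |T| * 9 ^ e) * (v ^ T * A v)) *
            ENNReal.ofReal (B θ) := by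
          gcongr 2 * ?_
          refine setLIntegral_mono' measurableSet_Ioo fun θ hθ => ?_
          rw [← ENNReal.ofReal_mul (by positivity)]
          refine ENNReal.ofReal_le_ofReal ?_
          rw [mul_assoc (_ * _), mul_assoc (v ^ T)]
          gcongr
          exact h v hv0 hv1 θ hθ.1 hθ.2
      _ = _ := by
          rw [lintegral_const_mul' _ _ ENNReal.ofReal_ne_top, ENNReal.ofReal_mul (by positivity), hX]
          ring
  refine (setLIntegral_mono' measurableSet_Ioo hin).trans ?_
  rw [lintegral_const_mul' _ _ ENNReal.ofReal_ne_top]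
  gcongr
  rw [lintegral_mul_const _ (by fun_prop)]

/-- Share the exponent as `(T + 1 + σ/2) + (1 + σ/2)`. The radial and the angular integral then each
contribute `(1 - r)^(-σ/2)`. The `0 + 1` matches the one-dimensional bound taken with `T = 0`. -/
lemma discIntegral_le_rpow {T σ : ℝ} (hT : -1 < T) (hσ : 0 < σ) :
    ∃ C : ℝ≥0∞, C ≠ ∞ ∧ ∀ r, 0 ≤ r → r < 1 →
      discIntegral T (T + 2 + σ) r ≤ C * ENNReal.ofReal ((1 - r) ^ (-σ)) := by
  refine ⟨ENNReal.ofReal (2 ^ |T| * 9 ^ (T + 2 + σ)) *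
    (ENNReal.ofReal (1 / (T + 1) + 1 / (σ / 2)) *
      (2 * ENNReal.ofReal (1 / (0 + 1) + 1 / (σ / 2)))), ?_, fun r hr0 hr => ?_⟩
  · exact ENNReal.mul_ne_top ENNReal.ofReal_ne_top (ENNReal.mul_ne_top ENNReal.ofReal_ne_top
      (ENNReal.mul_ne_top (by norm_num) ENNReal.ofReal_ne_top))
  have hδ : 0 < 1 - r := by linarith
  refine (discIntegral_le_of_le_mul (A := fun v => ((1 - r) + v) ^ (-(T + 1 + σ / 2)))
    (B := fun θ => ((1 - r) + θ) ^ (-(0 + 1 + σ / 2))) (by linarith) hr0 hr (by fun_prop)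
    (fun v hv => Real.rpow_nonneg (by linarith) _) ?_).trans ?_
  · intro v hv0 hv1 θ hθ _
    have hD : 0 < 1 - r + v + θ := by linarith
    rw [show -(T + 2 + σ) = -(T + 1 + σ / 2) + -(0 + 1 + σ / 2) by ring, Real.rpow_add hD]
    refine mul_le_mul ?_ ?_ (Real.rpow_nonneg hD.le _) (Real.rpow_nonneg (by linarith) _)
    · exact Real.rpow_le_rpow_of_nonpos (by linarith) (by linarith) (by linarith)
    · exact Real.rpow_le_rpow_of_nonpos (by linarith) (by linarith) (by linarith)
  · have h1 : ∫⁻ v in Set.Ioo (0 : ℝ) 1,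
        ENNReal.ofReal (v ^ T * ((1 - r) + v) ^ (-(T + 1 + σ / 2))) ≤
        ENNReal.ofReal (1 / (T + 1) + 1 / (σ / 2)) * ENNReal.ofReal ((1 - r) ^ (-(σ / 2))) :=
      (lintegral_mono_set Set.Ioo_subset_Ioi_self).trans
        (setLIntegral_rpow_mul_add_rpow_le hT (by linarith) hδ)
    have h2 : ∫⁻ θ in Set.Ioo (0 : ℝ) Real.pi,
        ENNReal.ofReal (((1 - r) + θ) ^ (-(0 + 1 + σ / 2))) ≤
        ENNReal.ofReal (1 / (0 + 1) + 1 / (σ / 2)) * ENNReal.ofReal ((1 - r) ^ (-(σ / 2))) := by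
      have := setLIntegral_rpow_mul_add_rpow_le (T := 0) (σ := σ / 2) (by norm_num) (by linarith) hδ
      simp only [Real.rpow_zero, one_mul] at this
      exact (lintegral_mono_set Set.Ioo_subset_Ioi_self).trans this
    refine (mul_le_mul_right (mul_le_mul' h1 (mul_le_mul_right h2 2)) _).trans_eq ?_
    have h3 : ENNReal.ofReal ((1 - r) ^ (-σ)) =
        ENNReal.ofReal ((1 - r) ^ (-(σ / 2))) * ENNReal.ofReal ((1 - r) ^ (-(σ / 2))) := by
      rw [← ENNReal.ofReal_mul (by positivity), ← Real.rpow_add hδ]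
      congr 2; ring
    rw [h3]
    ring

lemma norm_one_sub_mul_bounds {r : ℝ} (hr0 : 0 ≤ r) (hr : r < 1) {ζ : ℂ} (hζ : ‖ζ‖ < 1) :
    0 < ‖1 - (r : ℂ) * ζ‖ ∧ ‖1 - (r : ℂ) * ζ‖ ≤ 2 := by
  have hn : ‖(r : ℂ) * ζ‖ < 1 := by
    rw [norm_mul, Complex.norm_real, Real.norm_of_nonneg hr0]
    nlinarith [norm_nonneg ζ]
  have h1 := norm_sub_norm_le (1 : ℂ) ((r : ℂ) * ζ)
  have h2 := norm_sub_le (1 : ℂ) ((r : ℂ) * ζ)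
  rw [norm_one] at h1 h2
  exact ⟨by linarith, by linarith⟩

/-- Since `|1 - rζ| ≤ 2`, raising the exponent loses only a constant. This lets a convenient
exponent replace the given one, and bypasses the logarithmic case. -/
lemma discIntegral_le_of_le {e e' : ℝ} (he : e ≤ e') (T : ℝ) {r : ℝ} (hr0 : 0 ≤ r) (hr : r < 1) :
    discIntegral T e r ≤ ENNReal.ofReal (2 ^ (e' - e)) * discIntegral T e' r := by
  rw [discIntegral, discIntegral, ← lintegral_const_mul' _ _ ENNReal.ofReal_ne_top]
  refine setLIntegral_mono' measurableSet_ball fun ζ hζ => ?_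
  rw [mem_ball_zero_iff] at hζ
  obtain ⟨h0, h2⟩ := norm_one_sub_mul_bounds hr0 hr hζ
  rw [← ENNReal.ofReal_mul (by positivity)]
  refine ENNReal.ofReal_le_ofReal ?_
  have h3 : ‖1 - (r : ℂ) * ζ‖ ^ (-e) ≤ 2 ^ (e' - e) * ‖1 - (r : ℂ) * ζ‖ ^ (-e') := by
    rw [show -e = (e' - e) + -e' by ring, Real.rpow_add h0]
    gcongr
  have h4 : 0 ≤ (1 - ‖ζ‖ ^ 2) ^ T := Real.rpow_nonneg (by nlinarith [norm_nonneg ζ]) _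
  nlinarith [mul_le_mul_of_nonneg_left h3 h4]

lemma discIntegral_le_const {T e : ℝ} (hT : -1 < T) (he : e < T + 2) :
    ∃ C : ℝ≥0∞, C ≠ ∞ ∧ ∀ r, 0 ≤ r → r < 1 → discIntegral T e r ≤ C := by
  -- Room is left on both sides: with `e' = (T + 1 - ε) + (1 - ε)` both integrands become powers `-1
  -- + ε`, integrable at `0`, while `ε ≤ 1` and `ε ≤ T + 1` keep both shares nonnegative.
  obtain ⟨ε, hε0, hε1, hε2, hε3⟩ : ∃ ε : ℝ, 0 < ε ∧ ε ≤ 1 ∧ ε ≤ T + 1 ∧ e ≤ T + 2 - 2 * ε := by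
    refine ⟨min 1 (min (T + 1) ((T + 2 - e) / 2)), ?_, min_le_left _ _, ?_, ?_⟩
    · exact lt_min one_pos (lt_min (by linarith) (by linarith))
    · exact (min_le_right _ _).trans (min_le_left _ _)
    · have := (min_le_right (1 : ℝ) (min (T + 1) ((T + 2 - e) / 2))).trans (min_le_right _ _)
      linarith
  set e' := T + 2 - 2 * ε with he'
  refine ⟨ENNReal.ofReal (2 ^ (e' - e)) * (ENNReal.ofReal (2 ^ |T| * 9 ^ e') *
    ((∫⁻ v in Set.Ioc (0 : ℝ) 1, ENNReal.ofReal (v ^ (-1 + ε))) *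
      (2 * ∫⁻ θ in Set.Ioc (0 : ℝ) Real.pi, ENNReal.ofReal (θ ^ (-1 + ε))))), ?_,
      fun r hr0 hr => (discIntegral_le_of_le hε3 T hr0 hr).trans ?_⟩
  · rw [setLIntegral_Ioc_rpow (by linarith) one_pos,
      setLIntegral_Ioc_rpow (by linarith) Real.pi_pos]
    exact ENNReal.mul_ne_top ENNReal.ofReal_ne_top (ENNReal.mul_ne_top ENNReal.ofReal_ne_top
      (ENNReal.mul_ne_top ENNReal.ofReal_ne_top
        (ENNReal.mul_ne_top (by norm_num) ENNReal.ofReal_ne_top)))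
  gcongr
  refine (discIntegral_le_of_le_mul (A := fun v => v ^ (-(T + 1 - ε)))
    (B := fun θ => θ ^ (-1 + ε)) (by linarith) hr0 hr (by fun_prop)
    (fun v hv => Real.rpow_nonneg hv.le _) ?_).trans ?_
  · intro v hv0 hv1 θ hθ _
    have hD : 0 < 1 - r + v + θ := by linarith
    rw [show -e' = -(T + 1 - ε) + (-1 + ε) by rw [he']; ring, Real.rpow_add hD]
    refine mul_le_mul ?_ ?_ (Real.rpow_nonneg hD.le _) (Real.rpow_nonneg hv0.le _)
    · exact Real.rpow_le_rpow_of_nonpos hv0 (by linarith) (by linarith)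
    · exact Real.rpow_le_rpow_of_nonpos hθ (by linarith) (by linarith)
  · refine mul_le_mul_right (mul_le_mul' ?_ (mul_le_mul_right
      (lintegral_mono_set Set.Ioo_subset_Ioc_self) _)) _
    · refine (lintegral_mono_set Set.Ioo_subset_Ioc_self).trans_eq ?_
      refine setLIntegral_congr_fun measurableSet_Ioc fun v hv => ?_
      rw [← Real.rpow_add hv.1]
      congr 2; ring

/-! ### Lower bounds and the necessary conditions on the exponents -/

/-- On the cone `|θ| < v` with `v > 1 - r` one has `|1 - rζ| ≤ 3v`, and the angular integration
contributes the length `2v`, which raises the power by one. The cut at `v < 1/2` keeps the Jacobian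
`1 - v` above `1/2`. -/
lemma lintegral_cone_le_discIntegral {e r : ℝ} (T : ℝ) (he : 0 ≤ e) (hr0 : 0 ≤ r) (hr : r < 1) :
    ENNReal.ofReal (2 ^ (-|T|) * 3 ^ (-e)) *
      (∫⁻ v in Set.Ioo (1 - r) (1 / 2), ENNReal.ofReal (v ^ (T + 1 - e))) ≤
      discIntegral T e r := by
  rw [discIntegral_eq_polar, ← lintegral_const_mul' _ _ ENNReal.ofReal_ne_top]
  have hsub : Set.Ioo (1 - r) (1 / 2) ⊆ Set.Ioo (0 : ℝ) 1 := fun v hv =>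
    ⟨by linarith [hv.1], by linarith [hv.2]⟩
  refine le_trans ?_ (lintegral_mono_set hsub)
  refine setLIntegral_mono' measurableSet_Ioo fun v hv => ?_
  obtain ⟨hv0, hv1⟩ := hsub hv
  have hvh := hv.2
  have hpi := Real.pi_gt_three
  have hsub2 : Set.Ioo (-v) v ⊆ Set.Ioo (-Real.pi) Real.pi :=
    Set.Ioo_subset_Ioo (by linarith) (by linarith)
  refine le_trans ?_ (lintegral_mono_set hsub2)
  have hpt : ∀ θ ∈ Set.Ioo (-v) v, ENNReal.ofReal (2 ^ (-|T|) * 3 ^ (-e) * v ^ (T - e) / 2) ≤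
      ENNReal.ofReal
        ((1 - v) * ((v * (2 - v)) ^ T * ‖1 - (r : ℂ) * polarPt v θ‖ ^ (-e))) := by
    intro θ hθ
    refine ENNReal.ofReal_le_ofReal ?_
    have hθ' : |θ| < v := abs_lt.2 hθ
    have hN := norm_one_sub_polarPt_upper (θ := θ) hr0 hr hv0 hv1
    have hl := norm_one_sub_mul_bounds (ζ := polarPt v θ) hr0 hr
      (by rw [norm_polarPt hv1.le]; linarith)
    have h1 : (3 * v) ^ (-e) ≤ ‖1 - (r : ℂ) * polarPt v θ‖ ^ (-e) :=
      Real.rpow_le_rpow_of_nonpos hl.1 (by linarith [hv.1]) (by linarith)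
    have h2 : v ^ T * 2 ^ (-|T|) ≤ (v * (2 - v)) ^ T := by
      rw [Real.mul_rpow hv0.le (by linarith)]
      gcongr
      exact (rpow_bounds_of_mem_Icc T (by linarith) (by linarith)).1
    calc 2 ^ (-|T|) * 3 ^ (-e) * v ^ (T - e) / 2
        = 1 / 2 * ((v ^ T * 2 ^ (-|T|)) * (3 * v) ^ (-e)) := by
          rw [Real.mul_rpow (by norm_num) hv0.le, sub_eq_add_neg, Real.rpow_add hv0]; ring
      _ ≤ _ := by
          have h3 : 0 ≤ (v * (2 - v)) ^ T := Real.rpow_nonneg (by nlinarith) _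
          gcongr
          linarith
  refine le_trans ?_ (setLIntegral_mono' measurableSet_Ioo hpt)
  rw [setLIntegral_const, Real.volume_Ioo, ← ENNReal.ofReal_mul (by positivity),
    ← ENNReal.ofReal_mul (by positivity)]
  refine le_of_eq ?_
  congr 1
  rw [show T + 1 - e = (T - e) + 1 by ring, Real.rpow_add hv0, Real.rpow_one]
  ring

/-- On `|ζ| < 1/2` both factors of the integrand are bounded below, uniformly in `r`. -/
lemma exists_pos_le_discIntegral (T e : ℝ) :
    ∃ c : ℝ, 0 < c ∧ ∀ r, 0 ≤ r → r < 1 → ENNReal.ofReal c ≤ discIntegral T e r := by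
  have hb0 : 0 < (volume (Metric.ball (0 : ℂ) (1 / 2))).toReal :=
    ENNReal.toReal_pos (Metric.measure_ball_pos volume _ (by norm_num)).ne' measure_ball_lt_top.ne
  refine ⟨2 ^ (-|T|) * 2 ^ (-|e|) * (volume (Metric.ball (0 : ℂ) (1 / 2))).toReal, by positivity,
    fun r hr0 hr => ?_⟩
  rw [ENNReal.ofReal_mul (by positivity), ENNReal.ofReal_toReal measure_ball_lt_top.ne,
    ← setLIntegral_const]
  refine le_trans ?_ (lintegral_mono_set
    (Metric.ball_subset_ball (by norm_num : (1 / 2 : ℝ) ≤ 1)))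
  refine setLIntegral_mono' measurableSet_ball fun ζ hζ => ENNReal.ofReal_le_ofReal ?_
  rw [mem_ball_zero_iff] at hζ
  have hn := norm_nonneg ζ
  have hrz : ‖(r : ℂ) * ζ‖ ≤ 1 / 2 := by
    rw [norm_mul, Complex.norm_real, Real.norm_of_nonneg hr0]; nlinarith
  have h1 := norm_sub_norm_le (1 : ℂ) ((r : ℂ) * ζ)
  have h2 := norm_sub_le (1 : ℂ) ((r : ℂ) * ζ)
  rw [norm_one] at h1 h2
  have h3 := (rpow_bounds_of_mem_Icc (x := ‖1 - (r : ℂ) * ζ‖) (-e) (by linarith) (by linarith)).1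
  have h4 := (rpow_bounds_of_mem_Icc (x := 1 - ‖ζ‖ ^ 2) T (by nlinarith) (by nlinarith)).1
  rw [abs_neg] at h3
  gcongr
  exact Real.rpow_nonneg (by nlinarith) _

lemma neg_one_lt_of_setLIntegral_rpow_ne_top {s : ℝ}
    (h : ∫⁻ v in Set.Ioo (0 : ℝ) (1 / 2), ENNReal.ofReal (v ^ s) ≠ ∞) : -1 < s := by
  rw [← intervalIntegral.integrableOn_Ioo_rpow_iff (t := 1 / 2) (by norm_num)]
  refine ⟨by fun_prop, ?_⟩
  rw [hasFiniteIntegral_iff_ofReal]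
  · exact h.lt_top
  · filter_upwards [ae_restrict_mem measurableSet_Ioo] with v hv
    exact Real.rpow_nonneg hv.1.le _

/-- At `r = 0` the cone bound is void, but the integrand is radial, so the whole circle can be used
for each `v < 1/2`. -/
lemma discIntegral_zero_ne_top_iff (T : ℝ) : discIntegral T 0 0 ≠ ∞ ↔ -1 < T := by
  constructor
  · intro h
    refine neg_one_lt_of_setLIntegral_rpow_ne_top fun htop => h ?_
    rw [eq_top_iff]
    have hc : ENNReal.ofReal (2 ^ (-|T|) * (1 / 2)) * (∫⁻ v in Set.Ioo (0 : ℝ) (1 / 2),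
        ENNReal.ofReal (v ^ T)) = ∞ := by
      rw [htop]
      exact ENNReal.mul_top (by rw [Ne, ENNReal.ofReal_eq_zero, not_le]; positivity)
    rw [← hc, discIntegral_eq_polar, ← lintegral_const_mul' _ _ ENNReal.ofReal_ne_top]
    have hsub : Set.Ioo (0 : ℝ) (1 / 2) ⊆ Set.Ioo (0 : ℝ) 1 :=
      Set.Ioo_subset_Ioo le_rfl (by norm_num)
    refine le_trans ?_ (lintegral_mono_set hsub)
    refine setLIntegral_mono' measurableSet_Ioo fun v hv => ?_
    have hpi := Real.pi_gt_three
    have h2 : v ^ T * 2 ^ (-|T|) ≤ (v * (2 - v)) ^ T := by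
      rw [Real.mul_rpow hv.1.le (by linarith [hv.2])]
      have := Real.rpow_nonneg hv.1.le T
      gcongr
      exact (rpow_bounds_of_mem_Icc T (by linarith [hv.2]) (by linarith [hv.1])).1
    have h0 : 0 ≤ (v * (2 - v)) ^ T := Real.rpow_nonneg (by nlinarith [hv.1, hv.2]) _
    simp only [neg_zero, Real.rpow_zero, mul_one]
    rw [setLIntegral_const, Real.volume_Ioo, ← ENNReal.ofReal_mul (by positivity),
      ← ENNReal.ofReal_mul (mul_nonneg (by linarith [hv.2]) h0)]
    refine ENNReal.ofReal_le_ofReal ?_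
    have h5 : 1 / 2 * (v * (2 - v)) ^ T ≤ (1 - v) * (v * (2 - v)) ^ T := by
      gcongr; linarith [hv.2]
    nlinarith
  · intro h
    obtain ⟨C, hC, hle⟩ := discIntegral_le_const (T := T) (e := 0) h (by linarith)
    exact ne_top_of_le_ne_top hC (hle 0 le_rfl one_pos)

lemma not_forall_pos_le_mul_rpow {c C p δ₀ : ℝ} (hc : 0 < c) (hp : 0 < p) (hδ₀ : 0 < δ₀) :
    ¬ ∀ δ, 0 < δ → δ < δ₀ → c ≤ C * δ ^ p := by
  intro h
  have ht : Filter.Tendsto (fun δ : ℝ => C * δ ^ p) (nhdsWithin 0 (Set.Ioi 0)) (nhds (C * 0 ^ p)) :=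
    ((Real.continuousAt_rpow_const 0 p (Or.inr hp.le)).tendsto.mono_left
      nhdsWithin_le_nhds).const_mul C
  rw [Real.zero_rpow hp.ne', mul_zero] at ht
  have := ge_of_tendsto ht (Filter.mem_of_superset (Ioo_mem_nhdsGT hδ₀) fun δ hδ => h δ hδ.1 hδ.2)
  linarith

/-- Growth of the disc integrals forces the Forelli-Rudin conditions on the exponents. -/
lemma exponents_of_discIntegral_le {T e s : ℝ} {C : ℝ≥0∞} (hT : -1 < T) (hC : C ≠ ∞)
    (h : ∀ r, 0 ≤ r → r < 1 → discIntegral T e r ≤ C * ENNReal.ofReal ((1 - r) ^ (-s))) :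
    0 ≤ s ∧ e ≤ T + 2 + s ∧ (s = 0 → e < T + 2) := by
  obtain ⟨c, hc, hcle⟩ := exists_pos_le_discIntegral T e
  lift C to ℝ≥0 using hC
  have hreal : ∀ δ, 0 < δ → δ ≤ 1 → ∀ x, ENNReal.ofReal x ≤ discIntegral T e (1 - δ) →
      x ≤ C * δ ^ (-s) := by
    intro δ hδ0 hδ1 x hx
    have := hx.trans (h (1 - δ) (by linarith) (by linarith))
    rw [sub_sub_cancel, ← ENNReal.ofReal_coe_nnreal, ← ENNReal.ofReal_mul C.coe_nonneg] at this
    exact (ENNReal.ofReal_le_ofReal_iff (by positivity)).1 this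
  -- A negative `s` would make the upper bound tend to zero, against the uniform lower bound `c`.
  have hs : 0 ≤ s := by
    by_contra hs
    refine not_forall_pos_le_mul_rpow (C := C) (p := -s) hc (by linarith) one_pos
      fun δ h0 h1 => hreal δ h0 h1.le c (hcle _ (by linarith) (by linarith))
  refine ⟨hs, ?_, fun hs0 => ?_⟩
  -- The part `δ < v < 2δ` of the cone alone has size `δ^(T + 2 - e)`, which beats `δ^(-s)` as `δ →
  -- 0`. Taking `δ < 1/4` keeps `2δ` below `1/2`.
  · by_contra he
    push Not at he
    have he0 : 0 ≤ e := by linarith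
    set k : ℝ := 2 ^ (-|T|) * 3 ^ (-e) with hk
    have hk0 : 0 < k := by positivity
    refine not_forall_pos_le_mul_rpow (c := k * 2 ^ (T + 1 - e)) (C := C) (p := e - T - 2 - s)
      (δ₀ := 1 / 4) (by positivity) (by linarith) (by norm_num) fun δ h0 h1 => ?_
    have h2 : k * (2 ^ (T + 1 - e) * δ ^ (T + 2 - e)) ≤ C * δ ^ (-s) := by
      refine hreal δ h0 (by linarith) _ ?_
      refine le_trans ?_ (lintegral_cone_le_discIntegral T he0 (by linarith) (by linarith))
      rw [← hk, ENNReal.ofReal_mul hk0.le, sub_sub_cancel]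
      gcongr
      have hsub : Set.Ioo δ (2 * δ) ⊆ Set.Ioo δ (1 / 2) := Set.Ioo_subset_Ioo le_rfl (by linarith)
      refine le_trans ?_ (lintegral_mono_set hsub)
      calc ENNReal.ofReal (2 ^ (T + 1 - e) * δ ^ (T + 2 - e))
          = ∫⁻ _ in Set.Ioo δ (2 * δ), ENNReal.ofReal ((2 * δ) ^ (T + 1 - e)) := by
            rw [setLIntegral_const, Real.volume_Ioo, ← ENNReal.ofReal_mul (by positivity)]
            congr 1
            rw [Real.mul_rpow two_pos.le h0.le, show T + 2 - e = (T + 1 - e) + 1 by ring,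
              Real.rpow_add h0, Real.rpow_one]
            ring
        _ ≤ _ := by
            refine setLIntegral_mono' measurableSet_Ioo fun v hv => ENNReal.ofReal_le_ofReal ?_
            exact Real.rpow_le_rpow_of_nonpos (h0.trans hv.1) hv.2.le (by linarith)
    have h3 : 0 < δ ^ (e - T - 2) := Real.rpow_pos_of_pos h0 _
    have h4 := mul_le_mul_of_nonneg_right h2 h3.le
    rw [show e - T - 2 - s = -s + (e - T - 2) by ring, Real.rpow_add h0, ← mul_assoc]
    refine le_trans (le_of_eq ?_) h4
    have h5 : δ ^ (T + 2 - e) * δ ^ (e - T - 2) = 1 := by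
      rw [← Real.rpow_add h0, show T + 2 - e + (e - T - 2) = 0 by ring, Real.rpow_zero]
    linear_combination (-(k * 2 ^ (T + 1 - e))) * h5
  -- Here the cone integrals are bounded uniformly in `r`. Letting `r → 1`, monotone convergence
  -- makes `v^(T + 1 - e)` integrable at `0`, so `e < T + 2`; this also excludes the logarithmic
  -- case.
  · subst hs0
    by_contra he
    push Not at he
    have he0 : 0 ≤ e := by linarith
    set k : ℝ := 2 ^ (-|T|) * 3 ^ (-e) with hk
    have hk0 : 0 < k := by positivity
    have hk1 : ENNReal.ofReal k ≠ 0 := by rw [Ne, ENNReal.ofReal_eq_zero, not_le]; exact hk0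
    have hU : Set.Ioo (0 : ℝ) (1 / 2) = ⋃ j : ℕ, Set.Ioo (1 / ((j : ℝ) + 1)) (1 / 2) := by
      ext v
      simp only [Set.mem_iUnion, Set.mem_Ioo]
      constructor
      · rintro ⟨h0, h1⟩
        obtain ⟨j, hj⟩ := exists_nat_one_div_lt h0
        exact ⟨j, hj, h1⟩
      · rintro ⟨j, h0, h1⟩
        exact ⟨lt_trans (by positivity) h0, h1⟩
    have hlt : ∫⁻ v in Set.Ioo (0 : ℝ) (1 / 2), ENNReal.ofReal (v ^ (T + 1 - e)) ≤
        C / ENNReal.ofReal k := by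
      rw [hU, setLIntegral_iUnion_of_directed]
      · refine iSup_le fun j => ?_
        rw [ENNReal.le_div_iff_mul_le (Or.inl hk1) (Or.inl ENNReal.ofReal_ne_top), mul_comm]
        have hj : (1 : ℝ) / (j + 1) ≤ 1 := by
          rw [div_le_one (by positivity)]; linarith [(Nat.cast_nonneg j : (0 : ℝ) ≤ j)]
        have hj0 : (0 : ℝ) < 1 / (j + 1) := by positivity
        have h1 := lintegral_cone_le_discIntegral (r := 1 - 1 / ((j : ℝ) + 1)) T he0
          (by linarith) (by linarith)
        have h2 := h (1 - 1 / ((j : ℝ) + 1)) (by linarith) (by linarith)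
        rw [sub_sub_cancel] at h1 h2
        rw [neg_zero, Real.rpow_zero, ENNReal.ofReal_one, mul_one] at h2
        exact h1.trans h2
      · refine Monotone.directed_le fun i j hij => Set.Ioo_subset_Ioo ?_ le_rfl
        exact one_div_le_one_div_of_le (by positivity) (by exact_mod_cast Nat.succ_le_succ hij)
    have := neg_one_lt_of_setLIntegral_rpow_ne_top
      (ne_top_of_le_ne_top (ENNReal.div_ne_top ENNReal.coe_ne_top hk1) hlt)
    linarith

/-! ### From the ball to the disc -/

/-- The Forelli-Rudin integral over the unit ball of `ℂⁿ`. -/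
def frIntegral {n : ℕ} (t e : ℝ) (u : Cn n) : ℝ≥0∞ :=
  ∫⁻ z in Metric.ball (0 : Cn n) 1, ENNReal.ofReal ((1 - ‖z‖ ^ 2) ^ t * ‖1 - pairing z u‖ ^ (-e))

/-- The total mass of the weight `(1 - |z|²)^t` on the unit ball of `ℂⁿ`. -/
def ballIntegral (n : ℕ) (t : ℝ) : ℝ≥0∞ :=
  ∫⁻ z in Metric.ball (0 : Cn n) 1, ENNReal.ofReal ((1 - ‖z‖ ^ 2) ^ t)

lemma pairing_eq_inner {n : ℕ} (z u : Cn n) : pairing z u = inner ℂ u z := by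
  simp [pairing, PiLp.inner_apply]

lemma continuous_pairing {n : ℕ} : Continuous fun p : Cn n × Cn n => pairing p.1 p.2 := by
  simp only [pairing_eq_inner]; fun_prop

@[fun_prop] lemma Measurable.pairing {n : ℕ} {X : Type*} [MeasurableSpace X] {f g : X → Cn n}
    (hf : Measurable f) (hg : Measurable g) : Measurable fun x => pairing (f x) (g x) :=
  continuous_pairing.measurable.comp (hf.prodMk hg)

/-- An isometry `ℂ × ℂᵐ ≃ ℂᵐ⁺¹` which splits off the direction of `u`. -/
lemma exists_isometry_pairing {m : ℕ} (u : Cn (m + 1)) :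
    ∃ Φ : WithLp 2 (ℂ × Cn m) ≃ₗᵢ[ℝ] Cn (m + 1), ∀ x, pairing (Φ x) u = (‖u‖ : ℂ) * x.fst := by
  -- A unitary frame whose first vector is `u/‖u‖`; for `u = 0` any frame serves.
  obtain ⟨b, hb⟩ : ∃ b : OrthonormalBasis (Fin (m + 1)) ℂ (Cn (m + 1)), u = (‖u‖ : ℂ) • b 0 := by
    by_cases hu : u = 0
    · exact ⟨EuclideanSpace.basisFun _ ℂ, by simp [hu]⟩
    · have hn : ‖u‖ ≠ 0 := norm_ne_zero_iff.2 hu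
      have ho : Orthonormal ℂ (Set.domRestrict ({0} : Set (Fin (m + 1)))
          (fun _ => ((‖u‖ : ℂ)⁻¹) • u)) := by
        constructor
        · intro i
          simp [norm_smul, hn]
        · intro i j hij
          exact absurd (Subsingleton.elim i j) hij
      obtain ⟨b, hb⟩ := ho.exists_orthonormalBasis_extension_of_card_eq (by simp)
      refine ⟨b, ?_⟩
      rw [hb 0 rfl, smul_smul, mul_inv_cancel₀ (by exact_mod_cast hn), one_smul]
  let L : WithLp 2 (ℂ × Cn m) →ₗᵢ[ℝ] Cn (m + 1) :=
    { toFun := fun x => b.repr.symm (WithLp.toLp 2 (Fin.cons x.fst x.snd.ofLp))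
      map_add' := fun x y => by
        rw [← map_add]
        congr 1
        ext i
        refine Fin.cases ?_ (fun i => ?_) i <;> simp
      map_smul' := fun c x => by
        rw [RingHom.id_apply, ← Complex.coe_smul c (b.repr.symm _), ← LinearIsometryEquiv.map_smul]
        congr 1
        ext i
        refine Fin.cases ?_ (fun i => ?_) i <;> simp
      norm_map' := fun x => by
        have h : ‖b.repr.symm (WithLp.toLp 2 (Fin.cons x.fst x.snd.ofLp))‖ ^ 2 = ‖x‖ ^ 2 := by
          rw [LinearIsometryEquiv.norm_map, EuclideanSpace.norm_sq_eq, Fin.sum_univ_succ,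
            WithLp.prod_norm_sq_eq_of_L2, EuclideanSpace.norm_sq_eq]
          simp
        exact (sq_eq_sq₀ (norm_nonneg _) (norm_nonneg _)).1 h }
  have hfin : Module.finrank ℝ (WithLp 2 (ℂ × Cn m)) = Module.finrank ℝ (Cn (m + 1)) := by
    rw [(WithLp.linearEquiv 2 ℝ (ℂ × Cn m)).finrank_eq, Module.finrank_prod,
      finrank_real_of_complex, finrank_real_of_complex, finrank_real_of_complex]
    simp; ring
  refine ⟨L.toLinearIsometryEquiv hfin, fun x => ?_⟩
  have : L.toLinearIsometryEquiv hfin x =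
    b.repr.symm (WithLp.toLp 2 (Fin.cons x.fst x.snd.ofLp)) := rfl
  rw [this, pairing_eq_inner]
  nth_rewrite 1 [hb]
  rw [inner_smul_left, ← b.repr_apply_apply]
  simp

lemma lintegral_comp_smul_eq {m : ℕ} {R : ℝ} (hR : 0 < R) (f : Cn m → ℝ≥0∞) (hf : Measurable f) :
    ∫⁻ y, f y = ENNReal.ofReal (R ^ (2 * m)) * ∫⁻ y, f (R • y) := by
  have h := Measure.map_addHaar_smul (volume : Measure (Cn m)) hR.ne'
  have h2 : ∫⁻ y, f (R • y) = ∫⁻ y, f y ∂(Measure.map (fun x => R • x) (volume : Measure (Cn m))) :=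
    (lintegral_map hf (measurable_const_smul R)).symm
  have hd : Module.finrank ℝ (Cn m) = 2 * m := by
    rw [finrank_real_of_complex]; simp
  rw [h2, h, lintegral_smul_measure, hd, smul_eq_mul, ← mul_assoc, ← ENNReal.ofReal_mul (by positivity),
    abs_of_pos (by positivity), mul_inv_cancel₀ (by positivity), ENNReal.ofReal_one, one_mul]

/-- This is the fibre of the ball over `ζ`, with `s = 1 - |ζ|²`. Dilation by `√s` extracts `s^t`
from the weight and `s^m` from the real dimension `2m`. -/
lemma lintegral_slice {m : ℕ} (t : ℝ) {s : ℝ} (hs : 0 < s) :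
    ∫⁻ y : Cn m, {y | ‖y‖ ^ 2 < s}.indicator (fun y => ENNReal.ofReal ((s - ‖y‖ ^ 2) ^ t)) y =
      ENNReal.ofReal (s ^ (t + m)) * ballIntegral m t := by
  have hsq : 0 < √s := Real.sqrt_pos.2 hs
  have hms : MeasurableSet {y : Cn m | ‖y‖ ^ 2 < s} :=
    measurableSet_lt (by fun_prop) measurable_const
  rw [lintegral_comp_smul_eq hsq _ (Measurable.indicator (by fun_prop) hms), ballIntegral,
    ← lintegral_indicator measurableSet_ball, ← lintegral_const_mul' _ _ ENNReal.ofReal_ne_top,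
    ← lintegral_const_mul' _ _ ENNReal.ofReal_ne_top]
  refine lintegral_congr fun y => ?_
  have hn : ‖√s • y‖ ^ 2 = s * ‖y‖ ^ 2 := by
    rw [norm_smul, mul_pow, Real.norm_of_nonneg hsq.le, Real.sq_sqrt hs.le]
  by_cases hy : ‖y‖ < 1
  · have hy2 : ‖y‖ ^ 2 < 1 := by nlinarith [norm_nonneg y]
    rw [Set.indicator_of_mem (by simp only [Set.mem_ofPred_eq, hn]; nlinarith),
      Set.indicator_of_mem (by simpa using hy), hn, ← ENNReal.ofReal_mul (by positivity),
      ← ENNReal.ofReal_mul (by positivity)]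
    congr 1
    rw [show s - s * ‖y‖ ^ 2 = s * (1 - ‖y‖ ^ 2) by ring, Real.mul_rpow hs.le (by linarith),
      Real.rpow_add hs, pow_mul, Real.sq_sqrt hs.le, Real.rpow_natCast]
    ring
  · have hy2 : 1 ≤ ‖y‖ ^ 2 := by nlinarith
    rw [Set.indicator_of_notMem (by simp only [Set.mem_ofPred_eq, hn]; nlinarith),
      Set.indicator_of_notMem (by simpa using hy)]
    simp

/-- In coordinates `(ζ, y)` adapted to `u` the pairing is `‖u‖ζ`, so the kernel does not see `y`.
Tonelli's theorem integrates the weight over the fibres, which shifts its exponent from `t` to `t +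
m`. -/
lemma frIntegral_eq {m : ℕ} (t e : ℝ) (u : Cn (m + 1)) :
    frIntegral t e u = ballIntegral m t * discIntegral (t + m) e ‖u‖ := by
  obtain ⟨Φ, hΦ⟩ := exists_isometry_pairing u
  set g : Cn (m + 1) → ℝ≥0∞ := (Metric.ball (0 : Cn (m + 1)) 1).indicator fun z =>
    ENNReal.ofReal ((1 - ‖z‖ ^ 2) ^ t * ‖1 - pairing z u‖ ^ (-e)) with hg
  have hgm : Measurable g := Measurable.indicator (by fun_prop) measurableSet_ball
  have hmp : MeasurePreserving (fun p : ℂ × Cn m => Φ (WithLp.toLp 2 p)) :=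
    Φ.measurePreserving.comp (WithLp.volume_preserving_toLp ℂ (Cn m))
  rw [frIntegral, ← lintegral_indicator measurableSet_ball, ← hg, ← hmp.lintegral_comp hgm,
    Measure.volume_eq_prod, lintegral_prod (fun p : ℂ × Cn m => g (Φ (WithLp.toLp 2 p)))
      (hgm.comp hmp.measurable).aemeasurable,
    discIntegral, mul_comm, ← lintegral_mul_const _ (measurable_disc_integrand _ _ _),
    ← lintegral_indicator measurableSet_ball]
  refine lintegral_congr fun ζ => ?_
  have hn : ∀ y : Cn m, ‖Φ (WithLp.toLp 2 (ζ, y))‖ ^ 2 = ‖ζ‖ ^ 2 + ‖y‖ ^ 2 := fun y => by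
    rw [LinearIsometryEquiv.norm_map, WithLp.prod_norm_sq_eq_of_L2]; rfl
  by_cases hζ : ‖ζ‖ < 1
  · have hζ2 : 0 < 1 - ‖ζ‖ ^ 2 := by nlinarith [norm_nonneg ζ]
    rw [Set.indicator_of_mem (by simpa using hζ), mul_comm ((1 - ‖ζ‖ ^ 2) ^ (t + (m : ℝ))),
      ENNReal.ofReal_mul (by positivity), mul_assoc, ← lintegral_slice t hζ2,
      ← lintegral_const_mul' _ _ ENNReal.ofReal_ne_top]
    refine lintegral_congr fun y => ?_
    simp only [hg]
    by_cases hy : y ∈ {y : Cn m | ‖y‖ ^ 2 < 1 - ‖ζ‖ ^ 2}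
    · rw [Set.indicator_of_mem (by
          rw [mem_ball_zero_iff, ← sq_lt_one_iff₀ (norm_nonneg _), hn]; rw [Set.mem_ofPred_eq] at hy; linarith),
        Set.indicator_of_mem hy, hn, hΦ, ← ENNReal.ofReal_mul (by positivity), mul_comm,
        sub_add_eq_sub_sub]
      rfl
    · rw [Set.indicator_of_notMem (by
          rw [mem_ball_zero_iff, ← sq_lt_one_iff₀ (norm_nonneg _), hn]; rw [Set.mem_ofPred_eq] at hy; linarith),
        Set.indicator_of_notMem hy, mul_zero]
  · rw [Set.indicator_of_notMem (by simpa using hζ)]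
    have : ∀ y, g (Φ (WithLp.toLp 2 (ζ, y))) = 0 := fun y => by
      rw [hg, Set.indicator_of_notMem]
      rw [mem_ball_zero_iff, ← sq_lt_one_iff₀ (norm_nonneg _), hn]
      nlinarith [sq_nonneg ‖y‖]
    simp [this]

/-- The case `u = 0`, `e = 0` of the reduction; it drives the inductions on the dimension that
decide finiteness. -/
lemma ballIntegral_succ (m : ℕ) (t : ℝ) :
    ballIntegral (m + 1) t = ballIntegral m t * discIntegral (t + m) 0 0 := by
  have h := frIntegral_eq t 0 (0 : Cn (m + 1))
  rw [norm_zero] at h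
  rw [← h]
  simp [frIntegral, ballIntegral]

lemma discIntegral_ne_zero (T e : ℝ) {r : ℝ} (hr0 : 0 ≤ r) (hr : r < 1) :
    discIntegral T e r ≠ 0 := by
  obtain ⟨c, hc, hle⟩ := exists_pos_le_discIntegral T e
  exact ((ENNReal.ofReal_pos.2 hc).trans_le (hle r hr0 hr)).ne'

lemma ballIntegral_zero (t : ℝ) : ballIntegral 0 t ≠ 0 ∧ ballIntegral 0 t ≠ ∞ := by
  have h : ballIntegral 0 t = volume (Metric.ball (0 : Cn 0) 1) := by
    rw [ballIntegral, ← setLIntegral_one]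
    refine lintegral_congr fun z => ?_
    simp [Subsingleton.elim z 0]
  rw [h]
  exact ⟨(Metric.measure_ball_pos volume _ one_pos).ne', measure_ball_lt_top.ne⟩

lemma ballIntegral_ne_zero (m : ℕ) (t : ℝ) : ballIntegral m t ≠ 0 := by
  induction m with
  | zero => exact (ballIntegral_zero t).1
  | succ m ih =>
    rw [ballIntegral_succ]
    exact mul_ne_zero ih (discIntegral_ne_zero _ _ le_rfl one_pos)

lemma ballIntegral_ne_top (m : ℕ) {t : ℝ} (ht : -1 < t) : ballIntegral m t ≠ ∞ := by
  induction m with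
  | zero => exact (ballIntegral_zero t).2
  | succ m ih =>
    rw [ballIntegral_succ]
    refine ENNReal.mul_ne_top ih ((discIntegral_zero_ne_top_iff _).2 ?_)
    have : (0 : ℝ) ≤ m := m.cast_nonneg
    linarith

/-- The dimension must be positive, because over a point every exponent gives finite mass.
Finiteness descends to the lower-dimensional factor until the disc with `T = t` is reached. -/
lemma neg_one_lt_of_ballIntegral_ne_top (m : ℕ) {t : ℝ} (h : ballIntegral (m + 1) t ≠ ∞) :
    -1 < t := by
  induction m with
  | zero =>
    rw [ballIntegral_succ, Nat.cast_zero, add_zero] at h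
    exact (discIntegral_zero_ne_top_iff t).1
      (ENNReal.lt_top_of_mul_ne_top_right h (ballIntegral_ne_zero _ _)).ne
  | succ m ih =>
    rw [ballIntegral_succ] at h
    exact ih (ENNReal.lt_top_of_mul_ne_top_left h (discIntegral_ne_zero _ _ le_rfl one_pos)).ne

lemma ofReal_one_sub_sq_rpow_le {r : ℝ} (s : ℝ) (hr0 : 0 ≤ r) (hr : r < 1) :
    ENNReal.ofReal ((1 - r ^ 2) ^ s) ≤
        ENNReal.ofReal (2 ^ |s|) * ENNReal.ofReal ((1 - r) ^ s) ∧
      ENNReal.ofReal ((1 - r) ^ s) ≤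
        ENNReal.ofReal (2 ^ |s|) * ENNReal.ofReal ((1 - r ^ 2) ^ s) := by
  have hδ : 0 < 1 - r := by linarith
  have h1 : (1 - r ^ 2) ^ s = (1 + r) ^ s * (1 - r) ^ s := by
    rw [← Real.mul_rpow (by linarith) hδ.le]; congr 1; ring
  obtain ⟨hl, hu⟩ := rpow_bounds_of_mem_Icc s (x := 1 + r) (by linarith) (by linarith)
  have hp : 0 < (1 - r) ^ s := Real.rpow_pos_of_pos hδ _
  constructor
  · rw [← ENNReal.ofReal_mul (by positivity), h1]
    gcongr
  · rw [← ENNReal.ofReal_mul (by positivity), h1]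
    refine ENNReal.ofReal_le_ofReal ?_
    have h2 : (2 : ℝ) ^ |s| * 2 ^ (-|s|) = 1 := by
      rw [← Real.rpow_add two_pos, add_neg_cancel, Real.rpow_zero]
    calc (1 - r) ^ s = 2 ^ |s| * (2 ^ (-|s|) * (1 - r) ^ s) := by rw [← mul_assoc, h2, one_mul]
      _ ≤ _ := by gcongr

lemma frIntegral_zero {n : ℕ} (t e : ℝ) : frIntegral t e (0 : Cn n) = ballIntegral n t := by
  simp [frIntegral, ballIntegral, pairing]

lemma frIntegral_zero_ne_zero {n : ℕ} (t e : ℝ) : frIntegral t e (0 : Cn n) ≠ 0 := by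
  rw [frIntegral_zero]; exact ballIntegral_ne_zero n t

/-- The Forelli-Rudin estimates: the exponents for which the integrals over the ball grow at most
like `(1 - |u|²)^(-s)`. -/
theorem frIntegral_le_rpow_iff {n : ℕ} (hn : 1 ≤ n) (t e s : ℝ) :
    (∃ C : ℝ≥0∞, C ≠ ∞ ∧ ∀ u : Cn n, ‖u‖ < 1 →
      frIntegral t e u ≤ C * ENNReal.ofReal ((1 - ‖u‖ ^ 2) ^ (-s))) ↔
    -1 < t ∧ ((s = 0 ∧ e < n + 1 + t) ∨ (0 < s ∧ e ≤ n + 1 + t + s)) := by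
  obtain ⟨m, rfl⟩ : ∃ m, n = m + 1 := ⟨n - 1, by omega⟩
  have hm0 : (0 : ℝ) ≤ m := m.cast_nonneg
  have hA0 := ballIntegral_ne_zero m t
  push_cast
  constructor
  · rintro ⟨C, hC, h⟩
    -- At `u = 0` the bound says that the weight itself has finite mass.
    have ht : -1 < t := by
      refine neg_one_lt_of_ballIntegral_ne_top m ?_
      rw [← frIntegral_zero t e]
      refine ne_top_of_le_ne_top ?_ (h 0 (by simp))
      exact ENNReal.mul_ne_top hC ENNReal.ofReal_ne_top
    have hAt := ballIntegral_ne_top m ht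
    obtain ⟨h1, h2, h3⟩ := exponents_of_discIntegral_le (T := t + m) (e := e) (s := s)
      (C := C * ENNReal.ofReal (2 ^ |-s|) / ballIntegral m t) (by linarith)
      (ENNReal.div_ne_top (ENNReal.mul_ne_top hC ENNReal.ofReal_ne_top) hA0) fun r hr0 hr => by
        have hnorm : ‖EuclideanSpace.single (0 : Fin (m + 1)) (r : ℂ)‖ = r := by
          rw [PiLp.norm_single, Complex.norm_real, Real.norm_of_nonneg hr0]
        have h4 := h (EuclideanSpace.single 0 (r : ℂ)) (by rwa [hnorm])
        rw [frIntegral_eq, hnorm] at h4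
        rw [div_eq_mul_inv, mul_right_comm, ← div_eq_mul_inv,
          ENNReal.le_div_iff_mul_le (Or.inl hA0) (Or.inl hAt), mul_comm, mul_assoc]
        exact h4.trans (mul_le_mul_right (ofReal_one_sub_sq_rpow_le (-s) hr0 hr).1 C)
    refine ⟨ht, ?_⟩
    rcases h1.eq_or_lt with h0 | h0
    · exact Or.inl ⟨h0.symm, by linarith [h3 h0.symm]⟩
    · exact Or.inr ⟨h0, by linarith⟩
  · rintro ⟨ht, h | h⟩
    · obtain ⟨rfl, he⟩ := h
      obtain ⟨C, hC, hle⟩ := discIntegral_le_const (T := t + m) (e := e) (by linarith) (by linarith)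
      refine ⟨ballIntegral m t * C, ENNReal.mul_ne_top (ballIntegral_ne_top m ht) hC,
        fun u hu => ?_⟩
      rw [frIntegral_eq, neg_zero, Real.rpow_zero, ENNReal.ofReal_one, mul_one]
      gcongr
      exact hle _ (norm_nonneg u) hu
    -- Raising `e` to the extreme value `t + m + 2 + s` covers the bounded, logarithmic and power
    -- regimes at once.
    · obtain ⟨hs, he⟩ := h
      obtain ⟨C, hC, hle⟩ := discIntegral_le_rpow (T := t + m) (σ := s) (by linarith) hs
      refine ⟨ballIntegral m t * (ENNReal.ofReal (2 ^ (t + m + 2 + s - e)) *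
        (C * ENNReal.ofReal (2 ^ |-s|))), ?_, fun u hu => ?_⟩
      · exact ENNReal.mul_ne_top (ballIntegral_ne_top m ht) (ENNReal.mul_ne_top
          ENNReal.ofReal_ne_top (ENNReal.mul_ne_top hC ENNReal.ofReal_ne_top))
      · have hu0 := norm_nonneg u
        rw [frIntegral_eq, mul_assoc, mul_assoc, mul_assoc]
        gcongr
        refine (discIntegral_le_of_le (e' := t + m + 2 + s) (by linarith) _ hu0 hu).trans ?_
        gcongr
        refine (hle _ hu0 hu).trans ?_
        gcongr
        exact (ofReal_one_sub_sq_rpow_le (-s) hu0 hu).2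

/-! ### Minkowski-type inequalities -/

lemma rpow_lintegral_le_lintegral_rpow {Y : Type*} [MeasurableSpace Y] {ν : Measure Y} {q : ℝ}
    (hq : 1 ≤ q) {k : Y → ℝ≥0∞} (hk : AEMeasurable k ν) :
    (∫⁻ y, k y ∂ν) ^ q ≤ (∫⁻ y, k y ^ q ∂ν) * ν Set.univ ^ (q - 1) := by
  rcases hq.eq_or_lt with rfl | hq
  · simp
  have hc := Real.HolderConjugate.conjExponent hq
  have hq0 : 0 < q := by linarith
  have h := ENNReal.lintegral_mul_le_Lp_mul_Lq ν hc hk (g := fun _ => 1) aemeasurable_const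
  simp only [Pi.mul_apply, mul_one, ENNReal.one_rpow, lintegral_const, one_mul] at h
  calc (∫⁻ y, k y ∂ν) ^ q ≤ _ := ENNReal.rpow_le_rpow h hq0.le
    _ = _ := by
      rw [ENNReal.mul_rpow_of_nonneg _ _ hq0.le, ← ENNReal.rpow_mul, ← ENNReal.rpow_mul,
        one_div_mul_cancel hq0.ne', ENNReal.rpow_one]
      congr 2
      have := hc.inv_add_inv_eq_one
      rw [one_div, show q.conjExponent⁻¹ = 1 - q⁻¹ by linarith, sub_mul,
        inv_mul_cancel₀ hq0.ne', one_mul]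

/-- A form of Minkowski's integral inequality for kernels with uniformly bounded `L^q` norms. -/
lemma lintegral_rpow_lintegral_le {X Y : Type*} [MeasurableSpace X] [MeasurableSpace Y]
    {μ : Measure X} {ν : Measure Y} [SFinite μ] [SFinite ν] {q : ℝ} (hq : 1 ≤ q)
    {k : X × Y → ℝ≥0∞} (hk : Measurable k) {M : ℝ≥0∞}
    (h : ∀ᵐ y ∂ν, ∫⁻ x, k (x, y) ^ q ∂μ ≤ M) :
    ∫⁻ x, (∫⁻ y, k (x, y) ∂ν) ^ q ∂μ ≤ M * ν Set.univ ^ q := by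
  have hkq : Measurable fun p => k p ^ q := hk.pow_const q
  -- Because `M` does not depend on `y`, Hölder against the constant `1` followed by Tonelli already
  -- gives the sharp constant.
  calc ∫⁻ x, (∫⁻ y, k (x, y) ∂ν) ^ q ∂μ
      ≤ ∫⁻ x, (∫⁻ y, k (x, y) ^ q ∂ν) * ν Set.univ ^ (q - 1) ∂μ := lintegral_mono fun x =>
        rpow_lintegral_le_lintegral_rpow hq (hk.comp measurable_prodMk_left).aemeasurable
    _ = (∫⁻ y, ∫⁻ x, k (x, y) ^ q ∂μ ∂ν) * ν Set.univ ^ (q - 1) := by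
        rw [lintegral_mul_const _ hkq.lintegral_prod_right', lintegral_lintegral_swap]
        exact hkq.aemeasurable
    _ ≤ (∫⁻ _, M ∂ν) * ν Set.univ ^ (q - 1) := by
        gcongr ?_ * _
        exact lintegral_mono_ae h
    _ = _ := by
        rw [lintegral_const, mul_assoc]
        congr 1
        nth_rewrite 1 [← ENNReal.rpow_one (ν Set.univ)]
        rw [← ENNReal.rpow_add_of_nonneg _ _ zero_le_one (by linarith)]
        congr 1; ring

/-- The mixed-norm version for product kernels. -/
lemma mixed_lintegral_le {X Y : Type*} [MeasurableSpace X] [MeasurableSpace Y]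
    {ν₀ ν₁ : Measure X} {ρ : Measure (Y × Y)} [SFinite ν₀] [SFinite ν₁] [SFinite ρ] {q₀ q₁ : ℝ}
    (hq₀ : 1 ≤ q₀) (hq₁ : 1 ≤ q₁) {k₀ k₁ : X × Y → ℝ≥0∞} (hk₀ : Measurable k₀)
    (hk₁ : Measurable k₁) {M₀ M₁ : ℝ≥0∞} (h₀ : ∀ᵐ y ∂ρ, ∫⁻ z, k₀ (z, y.1) ^ q₀ ∂ν₀ ≤ M₀)
    (h₁ : ∀ᵐ y ∂ρ, ∫⁻ w, k₁ (w, y.2) ^ q₁ ∂ν₁ ≤ M₁) :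
    (∫⁻ w, (∫⁻ z, (∫⁻ y, k₀ (z, y.1) * k₁ (w, y.2) ∂ρ) ^ q₀ ∂ν₀) ^ (q₁ / q₀) ∂ν₁) ^ (1 / q₁) ≤
      M₀ ^ (1 / q₀) * M₁ ^ (1 / q₁) * ρ Set.univ := by
  have hq₀' : 0 < q₀ := by linarith
  have hq₁' : 0 < q₁ := by linarith
  have hk₁' : ∀ w, Measurable fun y : Y × Y => k₁ (w, y.2) := fun w => by fun_prop
  -- For fixed `w` the factor `k₁ (w, ·)` is absorbed into the measure, so the one-variable
  -- inequality applies to `k₀` alone.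
  have h1 : ∀ w, ∫⁻ z, (∫⁻ y, k₀ (z, y.1) * k₁ (w, y.2) ∂ρ) ^ q₀ ∂ν₀ ≤
      M₀ * (∫⁻ y, k₁ (w, y.2) ∂ρ) ^ q₀ := by
    intro w
    have h := lintegral_rpow_lintegral_le (μ := ν₀) (ν := ρ.withDensity fun y => k₁ (w, y.2)) hq₀
      (k := fun p : X × (Y × Y) => k₀ (p.1, p.2.1)) (by fun_prop) (M := M₀)
      (withDensity_absolutelyContinuous _ _ h₀)
    rw [withDensity_apply _ MeasurableSet.univ, Measure.restrict_univ] at h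
    refine le_trans (le_of_eq ?_) h
    refine lintegral_congr fun z => ?_
    rw [lintegral_withDensity_eq_lintegral_mul _ (hk₁' w) (by fun_prop)]
    simp only [Pi.mul_apply, mul_comm]
  have h2 := lintegral_rpow_lintegral_le (μ := ν₁) (ν := ρ) hq₁
      (k := fun p : X × (Y × Y) => k₁ (p.1, p.2.2)) (by fun_prop) (M := M₁) h₁
  have hVm : Measurable fun w => (∫⁻ y, k₁ (w, y.2) ∂ρ) ^ q₁ := by
    have : Measurable fun p : X × (Y × Y) => k₁ (p.1, p.2.2) := by fun_prop
    exact this.lintegral_prod_right'.pow_const _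
  calc _ ≤ (∫⁻ w, M₀ ^ (q₁ / q₀) * (∫⁻ y, k₁ (w, y.2) ∂ρ) ^ q₁ ∂ν₁) ^ (1 / q₁) := by
        refine ENNReal.rpow_le_rpow (lintegral_mono fun w => ?_) (by positivity)
        refine (ENNReal.rpow_le_rpow (h1 w) (by positivity)).trans_eq ?_
        rw [ENNReal.mul_rpow_of_nonneg _ _ (by positivity), ← ENNReal.rpow_mul,
          mul_div_cancel₀ _ hq₀'.ne']
    _ ≤ (M₀ ^ (q₁ / q₀) * (M₁ * ρ Set.univ ^ q₁)) ^ (1 / q₁) := by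
        rw [lintegral_const_mul _ hVm]
        gcongr
    _ = _ := by
        rw [ENNReal.mul_rpow_of_nonneg _ _ (by positivity),
          ENNReal.mul_rpow_of_nonneg _ _ (by positivity), ← ENNReal.rpow_mul, ← ENNReal.rpow_mul,
          mul_one_div_cancel hq₁'.ne', ENNReal.rpow_one, mul_assoc]
        congr 2
        field_simp

/-! ### Weighted measures and mixed norms -/

lemma ae_norm_lt_one (n : ℕ) : ∀ᵐ z ∂ballMeasure n, ‖z‖ < 1 := by
  have h : ∀ᵐ z ∂(volume.restrict (Metric.ball (0 : Cn n) 1)), ‖z‖ < 1 := by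
    filter_upwards [ae_restrict_mem measurableSet_ball] with z hz
    simpa using hz
  exact Measure.ae_smul_measure h _

lemma ae_prod_norm_lt_one (n : ℕ) :
    ∀ᵐ x ∂(ballMeasure n).prod (ballMeasure n), ‖x.1‖ < 1 ∧ ‖x.2‖ < 1 :=
  (Measure.quasiMeasurePreserving_fst.ae (ae_norm_lt_one n)).and
    (Measure.quasiMeasurePreserving_snd.ae (ae_norm_lt_one n))

lemma normConst_pos (n : ℕ) {θ : ℝ} (hθ : -1 < θ) : 0 < normConst n θ := by
  have hn : (0 : ℝ) ≤ n := n.cast_nonneg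
  exact div_pos (Real.Gamma_pos_of_pos (by linarith))
    (mul_pos (by exact_mod_cast n.factorial_pos) (Real.Gamma_pos_of_pos (by linarith)))

instance (n : ℕ) (θ : ℝ) : SFinite (weightedMeasure n θ) := by
  unfold weightedMeasure; infer_instance

lemma weightedMeasure_ac (n : ℕ) (θ : ℝ) : weightedMeasure n θ ≪ ballMeasure n :=
  withDensity_absolutelyContinuous _ _

lemma ballMeasure_ac (n : ℕ) {θ : ℝ} (hθ : -1 < θ) : ballMeasure n ≪ weightedMeasure n θ := by
  refine withDensity_absolutelyContinuous' (by fun_prop) ?_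
  filter_upwards [ae_norm_lt_one n] with z hz
  have : 0 < 1 - ‖z‖ ^ 2 := by nlinarith [norm_nonneg z]
  have := normConst_pos n hθ
  rw [Ne, ENNReal.ofReal_eq_zero, not_le]
  positivity

/-- The factor between `frIntegral` and integrals against `weightedMeasure`. -/
def massFactor (n : ℕ) (θ : ℝ) : ℝ≥0∞ :=
  ENNReal.ofReal (normConst n θ) * (volume (Metric.ball (0 : Cn n) 1))⁻¹

lemma massFactor_ne_zero (n : ℕ) {θ : ℝ} (hθ : -1 < θ) : massFactor n θ ≠ 0 :=
  mul_ne_zero (ENNReal.ofReal_pos.2 (normConst_pos n hθ)).ne'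
    (ENNReal.inv_ne_zero.2 measure_ball_lt_top.ne)

lemma massFactor_ne_top (n : ℕ) (θ : ℝ) : massFactor n θ ≠ ∞ :=
  ENNReal.mul_ne_top ENNReal.ofReal_ne_top
    (ENNReal.inv_ne_top.2 (Metric.measure_ball_pos volume _ one_pos).ne')

/-- One factor of the kernel, as a function of the first variable. -/
def profile {n : ℕ} (a c : ℝ) (z u : Cn n) : ℝ≥0∞ :=
  ENNReal.ofReal ((1 - ‖z‖ ^ 2) ^ a * ‖1 - pairing z u‖ ^ (-c))

@[fun_prop] lemma Measurable.profile {n : ℕ} (a c : ℝ) {X : Type*} [MeasurableSpace X]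
    {f g : X → Cn n} (hf : Measurable f) (hg : Measurable g) :
    Measurable fun x => profile a c (f x) (g x) := by
  unfold ForelliRudin.profile; fun_prop

lemma lintegral_profile_rpow {n : ℕ} {a c q β : ℝ} (hβ : -1 < β) (hq : 0 < q) (u : Cn n) :
    ∫⁻ z, profile a c z u ^ q ∂weightedMeasure n β =
      massFactor n β * frIntegral (q * a + β) (q * c) u := by
  rw [weightedMeasure, lintegral_withDensity_eq_lintegral_mul _ (by fun_prop) (by fun_prop),
    ballMeasure, lintegral_smul_measure, smul_eq_mul, massFactor, frIntegral,
    mul_comm (ENNReal.ofReal _), mul_assoc, ← lintegral_const_mul' _ _ ENNReal.ofReal_ne_top]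
  congr 1
  refine setLIntegral_congr_fun measurableSet_ball fun z hz => ?_
  rw [mem_ball_zero_iff] at hz
  have hz' : 0 < 1 - ‖z‖ ^ 2 := by nlinarith [norm_nonneg z]
  have hnc := (normConst_pos n hβ).le
  simp only [Pi.mul_apply, profile]
  rw [ENNReal.ofReal_rpow_of_nonneg (by positivity) hq.le, ← ENNReal.ofReal_mul (by positivity),
    ← ENNReal.ofReal_mul hnc, Real.mul_rpow (by positivity) (by positivity),
    ← Real.rpow_mul hz'.le, ← Real.rpow_mul (norm_nonneg _), Real.rpow_add hz']
  congr 1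
  rw [mul_comm a q, show -c * q = -(q * c) by ring]
  ring

lemma weight_pos {n : ℕ} (s : Fin 2 → ℝ) {x : Cn n × Cn n} (h1 : ‖x.1‖ < 1) (h2 : ‖x.2‖ < 1) :
    0 < weight s x := by
  have : 0 < 1 - ‖x.1‖ ^ 2 := by nlinarith [norm_nonneg x.1]
  have : 0 < 1 - ‖x.2‖ ^ 2 := by nlinarith [norm_nonneg x.2]
  unfold weight; positivity

@[fun_prop] lemma measurable_weight {n : ℕ} (s : Fin 2 → ℝ) :
    Measurable (weight s : Cn n × Cn n → ℝ) := by
  unfold weight; fun_prop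

lemma continuousAt_weight {n : ℕ} (s : Fin 2 → ℝ) {x : Cn n × Cn n} (h1 : ‖x.1‖ < 1)
    (h2 : ‖x.2‖ < 1) : ContinuousAt (weight s) x := by
  have h1' : 1 - ‖x.1‖ ^ 2 ≠ 0 := by nlinarith [norm_nonneg x.1]
  have h2' : 1 - ‖x.2‖ ^ 2 ≠ 0 := by nlinarith [norm_nonneg x.2]
  unfold weight
  refine ContinuousAt.mul ?_ ?_
  · exact ContinuousAt.rpow_const (by fun_prop) (Or.inl h1')
  · exact ContinuousAt.rpow_const (by fun_prop) (Or.inl h2')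

/-- For exponents `(1, 1)` the mixed norm is a weighted `L¹` norm on the product. -/
lemma mixedNorm_one {n : ℕ} {α : Fin 2 → ℝ} (hα : ∀ i, -1 < α i) {f : Cn n × Cn n → ℂ}
    (hf : AEStronglyMeasurable f ((ballMeasure n).prod (ballMeasure n))) :
    mixedNorm ![1, 1] α f =
      ENNReal.ofReal (normConst n (α 0)) * ENNReal.ofReal (normConst n (α 1)) *
        ∫⁻ y, ENNReal.ofReal (weight α y) * ‖f y‖ₑ ∂(ballMeasure n).prod (ballMeasure n) := by
  have hac : (weightedMeasure n (α 0)).prod (weightedMeasure n (α 1)) ≪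
      (ballMeasure n).prod (ballMeasure n) :=
    (weightedMeasure_ac n _).prod (weightedMeasure_ac n _)
  simp only [mixedNorm, Matrix.cons_val_zero, Matrix.cons_val_one, ENNReal.rpow_one, div_one]
  rw [← lintegral_prod_symm (fun y => ‖f y‖ₑ) (hf.mono_ac hac).enorm, weightedMeasure,
    weightedMeasure, prod_withDensity (by fun_prop) (by fun_prop),
    lintegral_withDensity_eq_lintegral_mul₀ (by fun_prop) hf.enorm,
    ← lintegral_const_mul' _ _ (ENNReal.mul_ne_top ENNReal.ofReal_ne_top ENNReal.ofReal_ne_top)]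
  refine lintegral_congr_ae ?_
  filter_upwards [ae_prod_norm_lt_one n] with y hy
  have h1 : 0 < 1 - ‖y.1‖ ^ 2 := by nlinarith [norm_nonneg y.1]
  have h0 := (normConst_pos n (hα 0)).le
  have h0' := (normConst_pos n (hα 1)).le
  simp only [Pi.mul_apply, weight]
  rw [ENNReal.ofReal_mul h0, ENNReal.ofReal_mul h0', ENNReal.ofReal_mul (by positivity)]
  ring

/-- Fatou's lemma for the mixed norms. -/
lemma mixedNorm_le_of_tendsto {n : ℕ} {q β : Fin 2 → ℝ} (hq : ∀ i, 0 < q i)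
    {g : ℕ → Cn n × Cn n → ℂ} {g' : Cn n × Cn n → ℂ} {B : ℝ≥0∞}
    (hm : ∀ k, AEStronglyMeasurable (g k) ((ballMeasure n).prod (ballMeasure n)))
    (ht : ∀ x : Cn n × Cn n, ‖x.1‖ < 1 → ‖x.2‖ < 1 →
      Filter.Tendsto (fun k => g k x) Filter.atTop (nhds (g' x)))
    (hB : ∀ k, mixedNorm q β (g k) ≤ B) : mixedNorm q β g' ≤ B := by
  have hq0 := hq 0
  have hq1 := hq 1
  set ν₀ := weightedMeasure n (β 0) with hν₀
  set ν₁ := weightedMeasure n (β 1) with hν₁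
  have hac : ν₀.prod ν₁ ≪ (ballMeasure n).prod (ballMeasure n) :=
    (weightedMeasure_ac n _).prod (weightedMeasure_ac n _)
  have hm' : ∀ k, AEMeasurable (fun x => ‖g k x‖ₑ ^ q 0) (ν₀.prod ν₁) := fun k =>
    ((hm k).mono_ac hac).enorm.pow_const _
  have hsec : ∀ᵐ w ∂ν₁, ∀ k, AEMeasurable (fun z => ‖g k (z, w)‖ₑ ^ q 0) ν₀ := by
    rw [ae_all_iff]
    intro k
    filter_upwards [((hm k).mono_ac hac).prod_swap.prodMk_left] with w hw
    exact hw.enorm.pow_const _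
  -- Fatou is applied twice. Between the two, the power `q 1 / q 0` passes through the liminf, being
  -- monotone and continuous on `[0,∞]`.
  have hinner : ∀ᵐ w ∂ν₁, (∫⁻ z, ‖g' (z, w)‖ₑ ^ q 0 ∂ν₀) ^ (q 1 / q 0) ≤
      Filter.liminf (fun k => (∫⁻ z, ‖g k (z, w)‖ₑ ^ q 0 ∂ν₀) ^ (q 1 / q 0)) Filter.atTop := by
    filter_upwards [hsec, (weightedMeasure_ac n _).ae_le (ae_norm_lt_one n)] with w hw hw1
    have h1 : ∫⁻ z, ‖g' (z, w)‖ₑ ^ q 0 ∂ν₀ ≤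
        Filter.liminf (fun k => ∫⁻ z, ‖g k (z, w)‖ₑ ^ q 0 ∂ν₀) Filter.atTop := by
      refine le_trans (le_of_eq ?_) (lintegral_liminf_le' hw)
      refine lintegral_congr_ae ?_
      filter_upwards [(weightedMeasure_ac n _).ae_le (ae_norm_lt_one n)] with z hz
      exact (((ht (z, w) hz hw1).enorm.ennrpow_const (q 0)).liminf_eq).symm
    refine (ENNReal.rpow_le_rpow h1 (by positivity)).trans_eq ?_
    exact (ENNReal.monotone_rpow_of_nonneg (by positivity)).map_liminf_of_continuousAt _
      ENNReal.continuous_rpow_const.continuousAt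
  have hout : ∀ k, ∫⁻ w, (∫⁻ z, ‖g k (z, w)‖ₑ ^ q 0 ∂ν₀) ^ (q 1 / q 0) ∂ν₁ ≤ B ^ q 1 := by
    intro k
    have h := ENNReal.rpow_le_rpow (hB k) hq1.le
    rwa [mixedNorm, ← ENNReal.rpow_mul, one_div_mul_cancel hq1.ne', ENNReal.rpow_one] at h
  rw [mixedNorm, one_div, ENNReal.rpow_inv_le_iff hq1]
  refine (lintegral_mono_ae hinner).trans ((lintegral_liminf_le' fun k => ?_).trans ?_)
  · exact (hm' k).lintegral_prod_left'.pow_const _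
  · exact (Filter.liminf_le_liminf (Filter.Eventually.of_forall hout)).trans_eq
      (Filter.liminf_const _)

/-! ### Necessity: testing on approximate point masses -/

/-- The properties shared by the kernels of `S` and `T`. -/
structure IsFRKernel {n : ℕ} (b c : Fin 2 → ℝ) (K : Cn n × Cn n → Cn n × Cn n → ℂ) : Prop where
  measurable : Measurable (Function.uncurry K)
  norm_eq : ∀ x y, ‖y.1‖ < 1 → ‖y.2‖ < 1 → ‖K x y‖ = weight b y *
    (‖1 - pairing x.1 y.1‖ ^ (-c 0) * ‖1 - pairing x.2 y.2‖ ^ (-c 1))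
  continuousAt : ∀ x y, ‖x.1‖ < 1 → ‖x.2‖ < 1 → ‖y.1‖ < 1 → ‖y.2‖ < 1 → ContinuousAt (K x) y

lemma IsFRKernel.enorm_eq {n : ℕ} {b c : Fin 2 → ℝ} {K : Cn n × Cn n → Cn n × Cn n → ℂ}
    (hK : IsFRKernel b c K) (a : Fin 2 → ℝ) {x y : Cn n × Cn n} (hx1 : ‖x.1‖ < 1)
    (hx2 : ‖x.2‖ < 1) (hy1 : ‖y.1‖ < 1) (hy2 : ‖y.2‖ < 1) :
    ‖(weight a x : ℂ)‖ₑ * ‖K x y‖ₑ = ENNReal.ofReal (weight b y) *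
      (profile (a 0) (c 0) x.1 y.1 * profile (a 1) (c 1) x.2 y.2) := by
  have hwa := weight_pos a hx1 hx2
  have hwb := weight_pos b hy1 hy2
  have h1 : 0 < 1 - ‖x.1‖ ^ 2 := by nlinarith [norm_nonneg x.1]
  have h2 : 0 < 1 - ‖x.2‖ ^ 2 := by nlinarith [norm_nonneg x.2]
  rw [← enorm_mul, ← ofReal_norm, norm_mul, hK.norm_eq x y hy1 hy2, Complex.norm_real,
    Real.norm_of_nonneg hwa.le, profile, profile, ← ENNReal.ofReal_mul (by positivity),
    ← ENNReal.ofReal_mul hwb.le, weight]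
  congr 1
  ring

lemma ballMeasure_prod_ball_pos {n : ℕ} {y : Cn n × Cn n} (h1 : ‖y.1‖ < 1) (h2 : ‖y.2‖ < 1)
    {r : ℝ} (hr : 0 < r) : 0 < (ballMeasure n).prod (ballMeasure n) (Metric.ball y r) := by
  have h : ∀ u : Cn n, ‖u‖ < 1 → 0 < ballMeasure n (Metric.ball u r) := by
    intro u hu
    rw [ballMeasure, Measure.smul_apply, Measure.restrict_apply measurableSet_ball, smul_eq_mul]
    refine ENNReal.mul_pos (ENNReal.inv_ne_zero.2 measure_ball_lt_top.ne) ?_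
    exact ((Metric.isOpen_ball.inter Metric.isOpen_ball).measure_pos volume
      ⟨u, Metric.mem_ball_self hr, by simpa using hu⟩).ne'
  rw [← ball_prod_same, Measure.prod_prod]
  exact ENNReal.mul_pos (h _ h1).ne' (h _ h2).ne'

/-- Averages over shrinking balls converge at points of continuity. -/
lemma tendsto_inv_smul_setIntegral_ball {Y : Type*} [PseudoMetricSpace Y] [MeasurableSpace Y]
    [OpensMeasurableSpace Y] {μ : Measure Y} [IsFiniteMeasure μ] {F : Y → ℂ} (hF : Measurable F)
    {y : Y} (hc : ContinuousAt F y) {r : ℕ → ℝ} (hr : Filter.Tendsto r Filter.atTop (nhds 0))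
    (hpos : ∀ k, 0 < μ (Metric.ball y (r k))) :
    Filter.Tendsto (fun k => (μ.real (Metric.ball y (r k)))⁻¹ • ∫ z in Metric.ball y (r k), F z ∂μ)
      Filter.atTop (nhds (F y)) := by
  have hs : Filter.Tendsto (fun k => Metric.ball y (r k)) Filter.atTop (nhds y).smallSets := by
    rw [Filter.tendsto_smallSets_iff]
    intro t ht
    obtain ⟨ε, hε, hsub⟩ := Metric.mem_nhds_iff.1 ht
    filter_upwards [hr.eventually (gt_mem_nhds hε)] with k hk
    exact (Metric.ball_subset_ball hk.le).trans hsub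
  have h := (hc.integral_sub_linear_isLittleO_ae (μ := μ)
    (hF.stronglyMeasurable.stronglyMeasurableAtFilter) hs).tendsto_inv_smul_nhds_zero
  have h2 := h.add_const (F y)
  rw [zero_add] at h2
  refine h2.congr fun k => ?_
  have hk : μ.real (Metric.ball y (r k)) ≠ 0 :=
    (ENNReal.toReal_pos (hpos k).ne' (measure_ne_top _ _)).ne'
  rw [smul_sub, inv_smul_smul₀ hk, sub_add_cancel]

/-- Test on normalized indicators of balls shrinking to `y`. Their images converge pointwise to the
column of the kernel at `y`, by continuity of `K x`, and Fatou's lemma transfers the norm bound to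
that column. -/
lemma le_of_isBoundedOp {n : ℕ} {a b c α q β : Fin 2 → ℝ}
    (hα : ∀ i, -1 < α i) (hq : ∀ i, 1 ≤ q i)
    {K : Cn n × Cn n → Cn n × Cn n → ℂ} (hK : IsFRKernel b c K)
    (hB : IsBoundedOp ![1, 1] α q β a K) :
    ∃ C : ℝ≥0∞, C ≠ ∞ ∧ ∀ y : Cn n × Cn n, ‖y.1‖ < 1 → ‖y.2‖ < 1 →
      ENNReal.ofReal (weight b y) *
        ((∫⁻ z, profile (a 0) (c 0) z y.1 ^ q 0 ∂weightedMeasure n (β 0)) ^ (1 / q 0) *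
          (∫⁻ w, profile (a 1) (c 1) w y.2 ^ q 1 ∂weightedMeasure n (β 1)) ^ (1 / q 1)) ≤
        C * ENNReal.ofReal (weight α y) := by
  obtain ⟨C, hC⟩ := hB
  have hq0 : 0 < q 0 := by linarith [hq 0]
  have hq1 : 0 < q 1 := by linarith [hq 1]
  set κ := ENNReal.ofReal (normConst n (α 0)) * ENNReal.ofReal (normConst n (α 1)) with hκ
  have hκt : κ ≠ ∞ := ENNReal.mul_ne_top ENNReal.ofReal_ne_top ENNReal.ofReal_ne_top
  -- `κ` collects the normalizing constants of the two measures; `2` comes from taking the balls so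
  -- small that `weight α` stays below twice its value at `y`.
  refine ⟨C * (κ * 2), ENNReal.mul_ne_top ENNReal.coe_ne_top (ENNReal.mul_ne_top hκt (by norm_num)),
    fun y hy1 hy2 => ?_⟩
  set μ := (ballMeasure n).prod (ballMeasure n) with hμ
  have hwα := weight_pos α hy1 hy2
  obtain ⟨r₀, hr₀, hr₀w⟩ : ∃ r₀ > 0, ∀ x ∈ Metric.ball y r₀, weight α x < 2 * weight α y := by
    have h := (continuousAt_weight α hy1 hy2).eventually
      (gt_mem_nhds (show weight α y < 2 * weight α y by linarith))
    exact Metric.eventually_nhds_iff_ball.1 h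
  set r : ℕ → ℝ := fun k => r₀ * (1 / ((k : ℝ) + 1)) with hr
  have hrpos : ∀ k, 0 < r k := fun k => by positivity
  have hrle : ∀ k, r k ≤ r₀ := fun k => by
    have : 1 / ((k : ℝ) + 1) ≤ 1 := by
      rw [div_le_one (by positivity)]; linarith [(Nat.cast_nonneg k : (0 : ℝ) ≤ k)]
    nlinarith [this]
  have hrt : Filter.Tendsto r Filter.atTop (nhds 0) := by
    have := (tendsto_one_div_add_atTop_nhds_zero_nat (𝕜 := ℝ)).const_mul r₀
    rwa [mul_zero] at this
  have hpos : ∀ k, 0 < μ (Metric.ball y (r k)) := fun k =>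
    ballMeasure_prod_ball_pos hy1 hy2 (hrpos k)
  have hposr : ∀ k, 0 < μ.real (Metric.ball y (r k)) := fun k =>
    ENNReal.toReal_pos (hpos k).ne' (measure_ne_top _ _)
  set f : ℕ → Cn n × Cn n → ℂ := fun k =>
    (Metric.ball y (r k)).indicator fun _ => (((μ.real (Metric.ball y (r k)))⁻¹ : ℝ) : ℂ) with hf
  have hfm : ∀ k, AEStronglyMeasurable (f k) μ := fun k =>
    (measurable_const.indicator measurableSet_ball).aestronglyMeasurable
  have hfn : ∀ k, mixedNorm ![1, 1] α (f k) ≤ κ * 2 * ENNReal.ofReal (weight α y) := by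
    intro k
    rw [mixedNorm_one hα (hfm k), mul_assoc κ]
    gcongr
    have h1 : ∀ x, ENNReal.ofReal (weight α x) * ‖f k x‖ₑ ≤
        (Metric.ball y (r k)).indicator (fun _ => 2 * ENNReal.ofReal (weight α y) *
          (μ (Metric.ball y (r k)))⁻¹) x := by
      intro x
      by_cases hx : x ∈ Metric.ball y (r k)
      · simp only [hf, Set.indicator_of_mem hx]
        have h2 : ‖(((μ.real (Metric.ball y (r k)))⁻¹ : ℝ) : ℂ)‖ₑ =
            (μ (Metric.ball y (r k)))⁻¹ := by
          rw [← ofReal_norm, Complex.norm_real,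
            Real.norm_of_nonneg (inv_nonneg.2 (hposr k).le), ENNReal.ofReal_inv_of_pos (hposr k),
            Measure.real, ENNReal.ofReal_toReal (measure_ne_top _ _)]
        rw [h2]
        gcongr
        rw [← ENNReal.ofReal_ofNat, ← ENNReal.ofReal_mul (by norm_num)]
        exact ENNReal.ofReal_le_ofReal
          (hr₀w x (Metric.ball_subset_ball (hrle k) hx)).le
      · simp [hf, Set.indicator_of_notMem hx]
    refine (lintegral_mono h1).trans_eq ?_
    rw [lintegral_indicator measurableSet_ball, setLIntegral_const, mul_assoc,
      ENNReal.inv_mul_cancel (hpos k).ne' (measure_ne_top _ _), mul_one]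
  have hfin : ∀ k, MemMixedLp ![1, 1] α (f k) := fun k => ⟨hfm k, (hfn k).trans_lt
    (ENNReal.mul_lt_top (ENNReal.mul_lt_top hκt.lt_top (by norm_num)) ENNReal.ofReal_lt_top)⟩
  have hlim : mixedNorm q β (fun x => (weight a x : ℂ) * K x y) ≤
      C * (κ * 2) * ENNReal.ofReal (weight α y) := by
    refine mixedNorm_le_of_tendsto (g := fun k => integralOp a K (f k))
      (fun i => by linarith [hq i]) (fun k => (hC (f k) (hfin k)).2.1.1) ?_ fun k => ?_
    · intro x hx1 hx2
      have hKx : Measurable (K x) := hK.measurable.comp measurable_prodMk_left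
      refine Filter.Tendsto.const_mul _ ((tendsto_inv_smul_setIntegral_ball (μ := μ) hKx
        (hK.continuousAt x y hx1 hx2 hy1 hy2) hrt hpos).congr fun k => ?_)
      rw [← integral_smul, ← integral_indicator measurableSet_ball]
      refine integral_congr_ae (Filter.Eventually.of_forall fun z => ?_)
      by_cases hz : z ∈ Metric.ball y (r k)
      · simp [hf, Set.indicator_of_mem hz, mul_comm]
      · simp [hf, Set.indicator_of_notMem hz]
    · refine (hC (f k) (hfin k)).2.2.trans ?_
      rw [mul_assoc (C : ℝ≥0∞)]
      gcongr
      exact hfn k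
  refine le_trans (le_of_eq ?_) hlim
  -- The product form of `|K|` now splits the mixed norm of the column into one integral per
  -- variable.
  set W := ENNReal.ofReal (weight b y) with hW
  set P₀ := ∫⁻ z, profile (a 0) (c 0) z y.1 ^ q 0 ∂weightedMeasure n (β 0) with hP₀
  set P₁ := ∫⁻ w, profile (a 1) (c 1) w y.2 ^ q 1 ∂weightedMeasure n (β 1) with hP₁
  have hin : ∀ w : Cn n, ‖w‖ < 1 →
      (∫⁻ z, ‖(weight a (z, w) : ℂ) * K (z, w) y‖ₑ ^ q 0 ∂weightedMeasure n (β 0)) ^ (q 1 / q 0) =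
      W ^ q 1 * P₀ ^ (q 1 / q 0) * profile (a 1) (c 1) w y.2 ^ q 1 := by
    intro w hw
    have h1 : ∫⁻ z, ‖(weight a (z, w) : ℂ) * K (z, w) y‖ₑ ^ q 0 ∂weightedMeasure n (β 0) =
        (W * profile (a 1) (c 1) w y.2) ^ q 0 * P₀ := by
      rw [hP₀, ← lintegral_const_mul _ (by fun_prop)]
      refine lintegral_congr_ae ?_
      filter_upwards [(weightedMeasure_ac n (β 0)).ae_le (ae_norm_lt_one n)] with z hz
      rw [enorm_mul, hK.enorm_eq a (x := (z, w)) hz hw hy1 hy2,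
        ← ENNReal.mul_rpow_of_nonneg _ _ hq0.le]
      congr 1
      simp only [hW]
      ring
    rw [h1, ENNReal.mul_rpow_of_nonneg _ _ (by positivity), ← ENNReal.rpow_mul,
      mul_div_cancel₀ _ hq0.ne', ENNReal.mul_rpow_of_nonneg _ _ hq1.le]
    ring
  have hout : ∫⁻ w, (∫⁻ z, ‖(weight a (z, w) : ℂ) * K (z, w) y‖ₑ ^ q 0
      ∂weightedMeasure n (β 0)) ^ (q 1 / q 0) ∂weightedMeasure n (β 1) =
      W ^ q 1 * P₀ ^ (q 1 / q 0) * P₁ := by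
    rw [hP₁, ← lintegral_const_mul _ (by fun_prop)]
    refine lintegral_congr_ae ?_
    filter_upwards [(weightedMeasure_ac n (β 1)).ae_le (ae_norm_lt_one n)] with w hw
    exact hin w hw
  rw [mixedNorm, hout, ENNReal.mul_rpow_of_nonneg _ _ (by positivity),
    ENNReal.mul_rpow_of_nonneg _ _ (by positivity), ← ENNReal.rpow_mul, ← ENNReal.rpow_mul,
    mul_one_div_cancel hq1.ne', ENNReal.rpow_one, mul_assoc]
  congr 3
  field_simp

/-! ### Sufficiency -/

/-- View `f` as the finite measure `ρ = weight α |f| dμ`, whose mass is `‖f‖` up to `κ`. Relative to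
`ρ` the kernel has columns of uniformly bounded norm, and `mixed_lintegral_le` integrates this
bound. -/
lemma isBoundedOp_of_profile_le {n : ℕ} {a b c α q β : Fin 2 → ℝ} (hα : ∀ i, -1 < α i)
    (hβ : ∀ i, -1 < β i) (hq : ∀ i, 1 ≤ q i) {K : Cn n × Cn n → Cn n × Cn n → ℂ}
    (hK : IsFRKernel b c K)
    (hP : ∀ i, ∃ C : ℝ≥0∞, C ≠ ∞ ∧ ∀ u : Cn n, ‖u‖ < 1 →
      ∫⁻ z, profile (a i) (c i) z u ^ q i ∂weightedMeasure n (β i) ≤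
        C * ENNReal.ofReal ((1 - ‖u‖ ^ 2) ^ (-(q i * (b i - α i))))) :
    IsBoundedOp ![1, 1] α q β a K := by
  choose M hMt hM using hP
  have hq0 : ∀ i, 0 < q i := fun i => by linarith [hq i]
  set μ := (ballMeasure n).prod (ballMeasure n) with hμ
  set κ := ENNReal.ofReal (normConst n (α 0)) * ENNReal.ofReal (normConst n (α 1)) with hκ
  have hκt : κ ≠ ∞ := ENNReal.mul_ne_top ENNReal.ofReal_ne_top ENNReal.ofReal_ne_top
  have hκ0 : κ ≠ 0 := mul_ne_zero (ENNReal.ofReal_pos.2 (normConst_pos n (hα 0))).ne'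
    (ENNReal.ofReal_pos.2 (normConst_pos n (hα 1))).ne'
  -- The exponent is `b i - α i` because `weight α` has been moved into `ρ`; the hypothesis `hP`
  -- cancels exactly this power.
  set k : Fin 2 → Cn n × Cn n → ℝ≥0∞ := fun i p =>
    profile (a i) (c i) p.1 p.2 * ENNReal.ofReal ((1 - ‖p.2‖ ^ 2) ^ (b i - α i)) with hk
  have hkm : ∀ i, Measurable (k i) := fun i => by simp only [hk]; fun_prop
  have hkM : ∀ i, ∀ u : Cn n, ‖u‖ < 1 → ∫⁻ z, k i (z, u) ^ q i ∂weightedMeasure n (β i) ≤ M i := by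
    intro i u hu
    have hu' : 0 < 1 - ‖u‖ ^ 2 := by nlinarith [norm_nonneg u]
    simp only [hk, ENNReal.mul_rpow_of_nonneg _ _ (hq0 i).le]
    rw [lintegral_mul_const _ (by fun_prop), ENNReal.ofReal_rpow_of_nonneg (by positivity)
      (hq0 i).le, ← Real.rpow_mul hu'.le]
    refine (mul_le_mul_left (hM i u hu) _).trans_eq ?_
    rw [mul_assoc, ← ENNReal.ofReal_mul (by positivity), ← Real.rpow_add hu',
      show -(q i * (b i - α i)) + (b i - α i) * q i = 0 by ring, Real.rpow_zero,
      ENNReal.ofReal_one, mul_one]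
  set D : ℝ≥0∞ := M 0 ^ (1 / q 0) * M 1 ^ (1 / q 1) with hD
  have hDt : D ≠ ∞ := ENNReal.mul_ne_top
    (ENNReal.rpow_ne_top_of_nonneg (by have := hq0 0; positivity) (hMt 0))
    (ENNReal.rpow_ne_top_of_nonneg (by have := hq0 1; positivity) (hMt 1))
  refine ⟨(D / κ).toNNReal, fun f hf => ?_⟩
  rw [ENNReal.coe_toNNReal (ENNReal.div_ne_top hDt hκ0)]
  obtain ⟨hfm, hff⟩ := hf
  have hdm : AEMeasurable (fun y => ENNReal.ofReal (weight α y) * ‖f y‖ₑ) μ :=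
    AEMeasurable.mul (by fun_prop) hfm.enorm
  set ρ := μ.withDensity fun y => ENNReal.ofReal (weight α y) * ‖f y‖ₑ with hρ
  have hNf : mixedNorm ![1, 1] α f = κ * ρ Set.univ := by
    rw [mixedNorm_one hα hfm, hρ, withDensity_apply _ MeasurableSet.univ, Measure.restrict_univ]
  have hρt : ρ Set.univ ≠ ∞ := by
    rw [hNf] at hff
    exact (ENNReal.lt_top_of_mul_ne_top_right hff.ne hκ0).ne
  have hρae : ∀ᵐ y ∂ρ, ‖y.1‖ < 1 ∧ ‖y.2‖ < 1 :=
    withDensity_absolutelyContinuous _ _ (ae_prod_norm_lt_one n)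
  have hmain := mixed_lintegral_le (ρ := ρ) (hq 0) (hq 1) (hkm 0) (hkm 1)
    (hρae.mono fun y hy => hkM 0 y.1 hy.1) (hρae.mono fun y hy => hkM 1 y.2 hy.2)
  rw [← hD] at hmain
  set H : Cn n × Cn n → ℝ≥0∞ := fun x => ∫⁻ y, k 0 (x.1, y.1) * k 1 (x.2, y.2) ∂ρ with hH
  have hHm : Measurable H := by
    have : Measurable fun p : (Cn n × Cn n) × (Cn n × Cn n) =>
        k 0 (p.1.1, p.2.1) * k 1 (p.1.2, p.2.2) := by
      have := hkm 0; have := hkm 1; fun_prop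
    exact this.lintegral_prod_right'
  have hHeq : ∀ x : Cn n × Cn n, ‖x.1‖ < 1 → ‖x.2‖ < 1 →
      ‖(weight a x : ℂ)‖ₑ * ∫⁻ y, ‖K x y * f y‖ₑ ∂μ = H x := by
    intro x hx1 hx2
    have hkx : Measurable fun y : Cn n × Cn n => k 0 (x.1, y.1) * k 1 (x.2, y.2) := by
      have := hkm 0; have := hkm 1; fun_prop
    rw [show H x = ∫⁻ y, k 0 (x.1, y.1) * k 1 (x.2, y.2) ∂ρ from rfl, hρ,
      lintegral_withDensity_eq_lintegral_mul₀ hdm hkx.aemeasurable,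
      ← lintegral_const_mul' _ _ enorm_ne_top]
    refine lintegral_congr_ae ?_
    filter_upwards [ae_prod_norm_lt_one n] with y hy
    have h1 : 0 < 1 - ‖y.1‖ ^ 2 := by nlinarith [norm_nonneg y.1]
    have h2 : 0 < 1 - ‖y.2‖ ^ 2 := by nlinarith [norm_nonneg y.2]
    have hwα := weight_pos α hy.1 hy.2
    have hw : ENNReal.ofReal (weight b y) = ENNReal.ofReal (weight α y) *
        (ENNReal.ofReal ((1 - ‖y.1‖ ^ 2) ^ (b 0 - α 0)) *
          ENNReal.ofReal ((1 - ‖y.2‖ ^ 2) ^ (b 1 - α 1))) := by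
      rw [← ENNReal.ofReal_mul (by positivity), ← ENNReal.ofReal_mul hwα.le, weight, weight,
        Real.rpow_sub h1, Real.rpow_sub h2]
      congr 1
      field_simp
    rw [enorm_mul, ← mul_assoc, hK.enorm_eq a hx1 hx2 hy.1 hy.2, hw]
    simp only [hk, Pi.mul_apply]
    ring
  have hle : ∀ x : Cn n × Cn n, ‖x.1‖ < 1 → ‖x.2‖ < 1 → ‖integralOp a K f x‖ₑ ≤ H x := by
    intro x hx1 hx2
    rw [← hHeq x hx1 hx2, integralOp, enorm_mul]
    gcongr
    exact enorm_integral_le_lintegral_enorm _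
  have hnorm : mixedNorm q β (integralOp a K f) ≤ D * ρ Set.univ := by
    refine le_trans (ENNReal.rpow_le_rpow (lintegral_mono_ae ?_)
      (by have := hq0 1; positivity)) hmain
    filter_upwards [(weightedMeasure_ac n (β 1)).ae_le (ae_norm_lt_one n)] with w hw
    refine ENNReal.rpow_le_rpow (lintegral_mono_ae ?_)
      (by have := hq0 1; have := hq0 0; positivity)
    filter_upwards [(weightedMeasure_ac n (β 0)).ae_le (ae_norm_lt_one n)] with z hz
    exact ENNReal.rpow_le_rpow (hle (z, w) hz hw) (hq0 0).le
  have hKfm : AEStronglyMeasurable (fun p : (Cn n × Cn n) × (Cn n × Cn n) => K p.1 p.2 * f p.2)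
      (μ.prod μ) := hK.measurable.aestronglyMeasurable.mul hfm.comp_snd
  refine ⟨?_, ⟨?_, hnorm.trans_lt (ENNReal.mul_lt_top hDt.lt_top hρt.lt_top)⟩, ?_⟩
  -- `H` has finite mixed norm, so it is finite almost everywhere. As `H` is the absolute integral
  -- times the positive factor `weight a x`, the defining integral converges absolutely.
  · have hm1 : Measurable fun w => ∫⁻ z, H (z, w) ^ q 0 ∂weightedMeasure n (β 0) :=
      (hHm.pow_const (q 0)).lintegral_prod_left'
    have hfin : ∫⁻ w, (∫⁻ z, H (z, w) ^ q 0 ∂weightedMeasure n (β 0)) ^ (q 1 / q 0)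
        ∂weightedMeasure n (β 1) ≠ ∞ := by
      intro htop
      have h1 := hmain
      rw [htop, ENNReal.top_rpow_of_pos (by have := hq0 1; positivity), top_le_iff] at h1
      exact ENNReal.mul_ne_top hDt hρt h1
    have hae : ∀ᵐ w ∂ballMeasure n, ∀ᵐ z ∂ballMeasure n, H (z, w) < ∞ := by
      refine (ballMeasure_ac n (hβ 1)).ae_le ?_
      filter_upwards [ae_lt_top (hm1.pow_const _) hfin] with w hw
      have hw' : ∫⁻ z, H (z, w) ^ q 0 ∂weightedMeasure n (β 0) ≠ ∞ := by
        intro htop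
        rw [htop, ENNReal.top_rpow_of_pos (by have := hq0 1; have := hq0 0; positivity)] at hw
        exact hw.ne rfl
      refine (ballMeasure_ac n (hβ 0)).ae_le ?_
      filter_upwards [ae_lt_top (by fun_prop) hw'] with z hz
      by_contra htop
      rw [not_lt, top_le_iff] at htop
      rw [htop, ENNReal.top_rpow_of_pos (hq0 0)] at hz
      exact hz.ne rfl
    have hms : MeasurableSet {x : Cn n × Cn n | H x < ∞} := hHm measurableSet_Iio
    have hae' : ∀ᵐ x ∂μ, x ∈ {x : Cn n × Cn n | H x < ∞} := by
      rw [Measure.ae_prod_mem_iff_ae_ae_mem hms]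
      exact (Measure.ae_ae_comm (p := fun z w => H (z, w) < ∞) hms).2 hae
    filter_upwards [hae', ae_prod_norm_lt_one n] with x hx hx1
    have hKx : Measurable (K x) := hK.measurable.comp measurable_prodMk_left
    refine ⟨hKx.aestronglyMeasurable.mul hfm, ?_⟩
    have hx' : H x < ∞ := hx
    rw [← hHeq x hx1.1 hx1.2] at hx'
    refine ENNReal.lt_top_of_mul_ne_top_right hx'.ne ?_
    rw [Ne, enorm_eq_zero, Complex.ofReal_eq_zero]
    exact (weight_pos a hx1.1 hx1.2).ne'
  · refine AEStronglyMeasurable.mul (Measurable.aestronglyMeasurable (by fun_prop)) ?_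
    exact hKfm.integral_prod_right'
  · rw [hNf, ← mul_assoc, ENNReal.div_mul_cancel hκ0 hκt]
    exact hnorm

/-! ### Separation of the two variables and the two kernels -/

/-- Boundedness is equivalent to a Forelli-Rudin growth estimate in each variable. -/
theorem isBoundedOp_iff {n : ℕ} {a b c α q β : Fin 2 → ℝ} (hα : ∀ i, -1 < α i)
    (hβ : ∀ i, -1 < β i) (hq : ∀ i, 1 ≤ q i) {K : Cn n × Cn n → Cn n × Cn n → ℂ}
    (hK : IsFRKernel b c K) :
    IsBoundedOp ![1, 1] α q β a K ↔ ∀ i, ∃ C : ℝ≥0∞, C ≠ ∞ ∧ ∀ u : Cn n, ‖u‖ < 1 →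
      frIntegral (q i * a i + β i) (q i * c i) u ≤
        C * ENNReal.ofReal ((1 - ‖u‖ ^ 2) ^ (-(q i * (b i - α i)))) := by
  have hq0 : ∀ i, 0 < q i := fun i => by linarith [hq i]
  constructor
  · intro h
    obtain ⟨C, hC, hle⟩ := le_of_isBoundedOp hα hq hK h
    have hN0 : ∀ i, (∫⁻ z, profile (a i) (c i) z (0 : Cn n) ^ q i ∂weightedMeasure n (β i)) ^
        (1 / q i) ≠ 0 := by
      intro i
      rw [lintegral_profile_rpow (hβ i) (hq0 i)]
      have h0 := mul_ne_zero (massFactor_ne_zero n (hβ i))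
        (frIntegral_zero_ne_zero (n := n) (q i * a i + β i) (q i * c i))
      have := hq0 i
      rw [Ne, ENNReal.rpow_eq_zero_iff_of_pos (by positivity)]
      exact h0
    -- `N` will be the column norm of the other variable at the origin. It must be nonzero to be
    -- divided out, but `N = ∞` is allowed, since the right side is finite.
    have key : ∀ i (N : ℝ≥0∞), N ≠ 0 → (∀ u : Cn n, ‖u‖ < 1 →
        ENNReal.ofReal ((1 - ‖u‖ ^ 2) ^ b i) *
          ((∫⁻ z, profile (a i) (c i) z u ^ q i ∂weightedMeasure n (β i)) ^ (1 / q i) * N) ≤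
          C * ENNReal.ofReal ((1 - ‖u‖ ^ 2) ^ α i)) →
        ∃ C : ℝ≥0∞, C ≠ ∞ ∧ ∀ u : Cn n, ‖u‖ < 1 →
          frIntegral (q i * a i + β i) (q i * c i) u ≤
            C * ENNReal.ofReal ((1 - ‖u‖ ^ 2) ^ (-(q i * (b i - α i)))) := by
      intro i N hN hu
      refine ⟨(C / N) ^ q i / massFactor n (β i), ENNReal.div_ne_top
        (ENNReal.rpow_ne_top_of_nonneg (hq0 i).le (ENNReal.div_ne_top hC hN))
        (massFactor_ne_zero n (hβ i)), fun u hu1 => ?_⟩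
      have hu' : 0 < 1 - ‖u‖ ^ 2 := by nlinarith [norm_nonneg u]
      have h1 := hu u hu1
      rw [lintegral_profile_rpow (hβ i) (hq0 i), mul_comm (ENNReal.ofReal _)] at h1
      have hb0 : ENNReal.ofReal ((1 - ‖u‖ ^ 2) ^ b i) ≠ 0 :=
        (ENNReal.ofReal_pos.2 (by positivity)).ne'
      rw [← ENNReal.le_div_iff_mul_le (Or.inl hb0) (Or.inl ENNReal.ofReal_ne_top),
        mul_div_assoc, ← ENNReal.ofReal_div_of_pos (by positivity), ← Real.rpow_sub hu',
        ← ENNReal.le_div_iff_mul_le (Or.inl hN) (Or.inr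
          (ENNReal.mul_ne_top hC ENNReal.ofReal_ne_top)), one_div,
        ENNReal.rpow_inv_le_iff (hq0 i), ENNReal.mul_div_right_comm,
        ENNReal.mul_rpow_of_nonneg _ _ (hq0 i).le, ENNReal.ofReal_rpow_of_nonneg (by positivity)
        (hq0 i).le, ← Real.rpow_mul hu'.le,
        show (α i - b i) * q i = -(q i * (b i - α i)) by ring, mul_comm (massFactor _ _),
        ← ENNReal.le_div_iff_mul_le (Or.inl (massFactor_ne_zero n (hβ i)))
          (Or.inl (massFactor_ne_top n _)), ENNReal.mul_div_right_comm] at h1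
      exact h1
    intro i
    fin_cases i
    · refine key 0 _ (hN0 1) fun u hu => ?_
      have := hle (u, 0) hu (by simp)
      simpa [weight] using this
    · refine key 1 _ (hN0 0) fun u hu => ?_
      have := hle (0, u) (by simp) hu
      simp only [weight, norm_zero, ne_eq, OfNat.ofNat_ne_zero, not_false_eq_true, zero_pow,
        sub_zero, Real.one_rpow, one_mul] at this
      rwa [mul_comm (_ ^ (1 / q 1))]
  · intro h
    refine isBoundedOp_of_profile_le hα hβ hq hK fun i => ?_
    obtain ⟨C, hC, hle⟩ := h i
    refine ⟨massFactor n (β i) * C, ENNReal.mul_ne_top (massFactor_ne_top n _) hC, fun u hu => ?_⟩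
    rw [lintegral_profile_rpow (hβ i) (hq0 i), mul_assoc]
    gcongr
    exact hle u hu

/-- The real part is positive by Cauchy-Schwarz, so the principal power is continuous and nonzero
there. -/
lemma one_sub_pairing_mem_slitPlane {n : ℕ} {z u : Cn n} (hz : ‖z‖ < 1) (hu : ‖u‖ < 1) :
    1 - pairing z u ∈ Complex.slitPlane := by
  have h1 : ‖pairing z u‖ < 1 := by
    rw [pairing_eq_inner]
    have := norm_inner_le_norm (𝕜 := ℂ) u z
    nlinarith [norm_nonneg z, norm_nonneg u]
  refine Or.inl ?_
  have := (Complex.re_le_norm (pairing z u)).trans_lt h1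
  simp only [Complex.sub_re, Complex.one_re]
  linarith

lemma continuous_pairing_right {n : ℕ} (z : Cn n) : Continuous fun u : Cn n => pairing z u := by
  simp only [pairing_eq_inner]; fun_prop

/-- The exponents are real, so a principal power has modulus `|1 - ⟨z,u⟩|^c`: no trace of the
argument survives. -/
lemma isFRKernel_kernelT {n : ℕ} (b c : Fin 2 → ℝ) :
    IsFRKernel b c (kernelT b c : Cn n × Cn n → Cn n × Cn n → ℂ) where
  measurable := by
    unfold kernelT Function.uncurry
    fun_prop
  norm_eq x y h1 h2 := by
    rw [kernelT, norm_div, norm_mul, Complex.norm_cpow_real, Complex.norm_cpow_real,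
      Complex.norm_real, Real.norm_of_nonneg (weight_pos b h1 h2).le,
      Real.rpow_neg (norm_nonneg _), Real.rpow_neg (norm_nonneg _), div_eq_mul_inv, mul_inv]
  continuousAt x y hx1 hx2 hy1 hy2 := by
    have hs1 := one_sub_pairing_mem_slitPlane hx1 hy1
    have hs2 := one_sub_pairing_mem_slitPlane hx2 hy2
    have hc1 : ContinuousAt (fun y : Cn n × Cn n => 1 - pairing x.1 y.1) y :=
      (continuous_const.sub ((continuous_pairing_right x.1).comp continuous_fst)).continuousAt
    have hc2 : ContinuousAt (fun y : Cn n × Cn n => 1 - pairing x.2 y.2) y :=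
      (continuous_const.sub ((continuous_pairing_right x.2).comp continuous_snd)).continuousAt
    refine ContinuousAt.div
      (Complex.continuous_ofReal.continuousAt.comp (continuousAt_weight b hy1 hy2))
      ((hc1.cpow continuousAt_const hs1).mul (hc2.cpow continuousAt_const hs2)) ?_
    exact mul_ne_zero (fun h => Complex.slitPlane_ne_zero hs1 ((Complex.cpow_eq_zero_iff _ _).1 h).1)
      (fun h => Complex.slitPlane_ne_zero hs2 ((Complex.cpow_eq_zero_iff _ _).1 h).1)

lemma isFRKernel_kernelS {n : ℕ} (b c : Fin 2 → ℝ) :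
    IsFRKernel b c (kernelS b c : Cn n × Cn n → Cn n × Cn n → ℂ) where
  measurable := by
    unfold kernelS Function.uncurry
    fun_prop
  norm_eq x y h1 h2 := by
    have hw := weight_pos b h1 h2
    rw [kernelS, Complex.norm_real, Real.norm_of_nonneg (by positivity),
      Real.rpow_neg (norm_nonneg _), Real.rpow_neg (norm_nonneg _), div_eq_mul_inv, mul_inv]
  continuousAt x y hx1 hx2 hy1 hy2 := by
    have hs1 := norm_pos_iff.2 (Complex.slitPlane_ne_zero (one_sub_pairing_mem_slitPlane hx1 hy1))
    have hs2 := norm_pos_iff.2 (Complex.slitPlane_ne_zero (one_sub_pairing_mem_slitPlane hx2 hy2))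
    have hc1 : ContinuousAt (fun y : Cn n × Cn n => ‖1 - pairing x.1 y.1‖) y :=
      (continuous_const.sub ((continuous_pairing_right x.1).comp continuous_fst)).norm.continuousAt
    have hc2 : ContinuousAt (fun y : Cn n × Cn n => ‖1 - pairing x.2 y.2‖) y :=
      (continuous_const.sub ((continuous_pairing_right x.2).comp continuous_snd)).norm.continuousAt
    refine Complex.continuous_ofReal.continuousAt.comp ?_
    refine ContinuousAt.div (continuousAt_weight b hy1 hy2)
      ((hc1.rpow_const (Or.inl hs1.ne')).mul (hc2.rpow_const (Or.inl hs2.ne'))) ?_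
    positivity

/-- Dividing by `q` translates `t = q a + β`, `e = q c`, `s = q (b - α)` back to the original
parameters. -/
lemma exponents_iff {n : ℕ} {a b c α q β : ℝ} (hq : 1 ≤ q) :
    (-1 < q * a + β ∧ ((q * (b - α) = 0 ∧ q * c < n + 1 + (q * a + β)) ∨
      (0 < q * (b - α) ∧ q * c ≤ n + 1 + (q * a + β) + q * (b - α)))) ↔
    -(q * a) < β + 1 ∧ ((α < b ∧ c ≤ a + b - α + (n + 1 + β) / q) ∨
      (α = b ∧ c < a + (n + 1 + β) / q)) := by
  have hq0 : 0 < q := by linarith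
  have h1 : q * c < n + 1 + (q * a + β) ↔ c < a + (n + 1 + β) / q := by
    rw [← mul_lt_mul_iff_right₀ hq0 (b := c), mul_add, mul_div_cancel₀ _ hq0.ne']
    constructor <;> intro h <;> linarith
  have h2 : q * c ≤ n + 1 + (q * a + β) + q * (b - α) ↔ c ≤ a + b - α + (n + 1 + β) / q := by
    rw [← mul_le_mul_iff_right₀ hq0 (b := c), mul_add, mul_div_cancel₀ _ hq0.ne']
    constructor <;> intro h <;> linarith
  have h3 : q * (b - α) = 0 ↔ α = b := by
    rw [mul_eq_zero, or_iff_right hq0.ne', sub_eq_zero, eq_comm]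
  have h4 : 0 < q * (b - α) ↔ α < b := by
    rw [mul_pos_iff_of_pos_left hq0, sub_pos]
  have h5 : -1 < q * a + β ↔ -(q * a) < β + 1 := by
    constructor <;> intro h <;> linarith
  rw [h1, h2, h3, h4, h5, or_comm]

end ForelliRudin

end

theorem theorem1p4 (n : ℕ) (hn : 1 ≤ n) (a b c α β q : Fin 2 → ℝ)
    (hα : ∀ i, -1 < α i) (hβ : ∀ i, -1 < β i) (hq : ∀ i, 1 ≤ q i) :
    List.TFAE [
      ForelliRudin.BoundedS n a b c ![1, 1] α q β,
      ForelliRudin.BoundedT n a b c ![1, 1] α q β,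
      (∀ i, -(q i * a i) < β i + 1 ∧ α i < b i ∧
          c i ≤ a i + b i - α i + (n + 1 + β i) / q i) ∨
        (∀ i, -(q i * a i) < β i + 1 ∧ α i = b i ∧ c i < a i + (n + 1 + β i) / q i) ∨
        ((∀ i, -(q i * a i) < β i + 1) ∧
          α 0 = b 0 ∧ c 0 < a 0 + (n + 1 + β 0) / q 0 ∧
          α 1 < b 1 ∧ c 1 ≤ a 1 + b 1 - α 1 + (n + 1 + β 1) / q 1) ∨
        ((∀ i, -(q i * a i) < β i + 1) ∧
          α 0 < b 0 ∧ c 0 ≤ a 0 + b 0 - α 0 + (n + 1 + β 0) / q 0 ∧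
          α 1 = b 1 ∧ c 1 < a 1 + (n + 1 + β 1) / q 1)] := by
  have hS := ForelliRudin.isBoundedOp_iff (n := n) (a := a) hα hβ hq
    (ForelliRudin.isFRKernel_kernelS b c)
  have hT := ForelliRudin.isBoundedOp_iff (n := n) (a := a) hα hβ hq
    (ForelliRudin.isFRKernel_kernelT b c)
  simp only [ForelliRudin.frIntegral_le_rpow_iff hn, ForelliRudin.exponents_iff (hq _)] at hS hT
  tfae_have 1 ↔ 2 := hS.trans hT.symm
  tfae_have 1 ↔ 3 := by
    refine hS.trans ?_
    -- The four systems are the combinations of `α i < b i` or `α i = b i` for the two variables.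
    simp only [Fin.forall_fin_two]
    constructor
    · rintro ⟨⟨h0, h | h⟩, h1, h' | h'⟩
      · exact Or.inl ⟨⟨h0, h⟩, h1, h'⟩
      · exact Or.inr (Or.inr (Or.inr ⟨⟨h0, h1⟩, h.1, h.2, h'⟩))
      · exact Or.inr (Or.inr (Or.inl ⟨⟨h0, h1⟩, h.1, h.2, h'⟩))
      · exact Or.inr (Or.inl ⟨⟨h0, h⟩, h1, h'⟩)
    · rintro (⟨⟨h0, h⟩, h1, h'⟩ | ⟨⟨h0, h⟩, h1, h'⟩ | ⟨⟨h0, h1⟩, h, h2, h'⟩ |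
        ⟨⟨h0, h1⟩, h, h2, h'⟩)
      · exact ⟨⟨h0, Or.inl h⟩, h1, Or.inl h'⟩
      · exact ⟨⟨h0, Or.inr h⟩, h1, Or.inr h'⟩
      · exact ⟨⟨h0, Or.inr ⟨h, h2⟩⟩, h1, Or.inl h'⟩
      · exact ⟨⟨h0, Or.inl ⟨h, h2⟩⟩, h1, Or.inr h'⟩
  tfae_finish
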